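/- Let $P\subset\mathbb{R}^d$ be an $n$-dimensional simple lattice polytope, i.e. $P$ is a polytope of dimension $n$ all of whose vertices lie in $\mathbb{Z}^d$ and each of whose vertices lies on exactly $n$ edges. Let $\mathcal F_p(P)$ be the set of $p$-dimensional faces of $P$ (with $\mathcal F_n(P)=\{P\}$). For a face $F$ let $\mathrm{Vol}_{\mathbb Z}(F)$ be its lattice volume, i.e. the volume in the affine hull of $F$, normalized so that a fundamental parallelepiped of the lattice of integral vectors parallel to this affine hull has volume $(\dim F)!$. Put $$c(P)=\sum_{p=0}^n(-1)^{n-p}(p+1)\sum_{F\in\mathcal F_p(P)}\mathrm{Vol}_{\mathbb Z}(F),$$ and for $i\ge 1$ let $I_p(i)=\sum_{F\in\mathcal F_p(P)}\#\big(\operatorname{relint}(iF)\cap\mathbb{Z}^d\big)$ be the number of integral points in the relative interiors of the $i$-th dilates of the $p$-dimensional faces of $P$. If $n$ is odd and $m=(n+1)/2$, then $$c(P)=\sum_{p=m}^n\ \sum_{i=1}^{p+1-m}(-1)^{m-i}\binom{p+1}{m+i}\,2\,i\,I_p(i).$$ If $n$ is even and $m=n/2$, then $$c(P)=\sum_{p=m}^n\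 \sum_{i=1}^{p+1-m}(-1)^{m+1-i}\left(\binom{p+1}{m+i}-\binom{p+1}{m+i+1}\right) i\,I_p(i).$$ -/

import Mathlib

open scoped Pointwise

/-- The lattice `ℤ^d` inside `ℝ^d`. -/
def intLattice (d : ℕ) : Submodule ℤ (Fin d → ℝ) where
  carrier := {x | ∀ j, ∃ k : ℤ, (k : ℝ) = x j}
  zero_mem' := fun _ => ⟨0, by simp⟩
  add_mem' := by
    intro a b ha hb j
    obtain ⟨k, hk⟩ := ha j
    obtain ⟨l, hl⟩ := hb j
    exact ⟨k + l, by simp [hk, hl]⟩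
  smul_mem' := by
    intro c x hx j
    obtain ⟨k, hk⟩ := hx j
    exact ⟨c * k, by simp [hk]⟩

/-- A lattice polytope: the convex hull of a nonempty finite set of points of `ℝ^d`, all of whose
vertices (extreme points) lie in `ℤ^d`. -/
structure IsLatticePolytope {d : ℕ} (P : Set (Fin d → ℝ)) : Prop where
  exists_hull : ∃ S : Set (Fin d → ℝ), S.Finite ∧ S.Nonempty ∧ P = convexHull ℝ S
  vertices_integral : ∀ v ∈ P.extremePoints ℝ, v ∈ intLattice d

/-- The dimension of a (nonempty) convex set: the dimension of its affine hull. -/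
noncomputable def polyDim {d : ℕ} (P : Set (Fin d → ℝ)) : ℕ :=
  Module.finrank ℝ (vectorSpan ℝ P)

/-- The set of `p`-dimensional faces of `P`. A face is a nonempty subset of `P` on which some
linear functional attains its maximum over `P`; the zero functional gives `P` itself. -/
def faces {d : ℕ} (P : Set (Fin d → ℝ)) (p : ℕ) : Set (Set (Fin d → ℝ)) :=
  {F | F.Nonempty ∧ IsExposed ℝ P F ∧ polyDim F = p}

/-- A polytope is simple if each of its vertices lies on exactly `dim P` edges. -/
def IsSimplePolytope {d : ℕ} (P : Set (Fin d → ℝ)) : Prop :=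
  ∀ v ∈ P.extremePoints ℝ, {F ∈ faces P 1 | v ∈ F}.encard = (polyDim P : ℕ∞)

/-- The lattice `W ∩ ℤ^d` in the linear subspace `W` parallel to the affine hull of `F`. -/
def directionLattice {d : ℕ} (F : Set (Fin d → ℝ)) : Submodule ℤ (vectorSpan ℝ F) :=
  (intLattice d).comap ((vectorSpan ℝ F).subtype.restrictScalars ℤ)

open Classical in
/-- The lattice volume `Vol_ℤ(F)`: translate `F` by one of its points into the linear subspace `W`
parallel to its affine hull, and take there the translation-invariant volume normalized so that a
fundamental parallelepiped of `W ∩ ℤ^d` has volume `(dim F)!`. (The quotient of the Haar measure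
by the covolume does not depend on the choice of the Haar measure on `W`.) -/
noncomputable def latticeVolume {d : ℕ} (F : Set (Fin d → ℝ)) : ℝ :=
  if h : F.Nonempty then
    ((polyDim F).factorial : ℝ) *
      ((MeasureTheory.Measure.addHaar : MeasureTheory.Measure (vectorSpan ℝ F)).real
          {w | h.some + (w : Fin d → ℝ) ∈ F} /
        ZLattice.covolume (directionLattice F) MeasureTheory.Measure.addHaar)
  else 0

/-- The number `c(P) = ∑_{p=0}^n (-1)^{n-p} (p+1) ∑_{F ∈ 𝓕_p(P)} Vol_ℤ(F)`, where `n = dim P`. -/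
noncomputable def discriminantNumber {d : ℕ} (P : Set (Fin d → ℝ)) : ℝ :=
  ∑ p ∈ Finset.range (polyDim P + 1),
    (-1 : ℝ) ^ (polyDim P - p) * ((p : ℝ) + 1) * ∑ᶠ F ∈ faces P p, latticeVolume F

/-- `I_p(i)`: the number of lattice points in the relative interiors of the `i`-th dilates of the
`p`-dimensional faces of `P`. -/
noncomputable def interiorPoints {d : ℕ} (P : Set (Fin d → ℝ)) (p i : ℕ) : ℕ :=
  ∑ᶠ F ∈ faces P p, {x | x ∈ intLattice d ∧ x ∈ intrinsicInterior ℝ ((i : ℝ) • F)}.ncard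

/-!
By Ehrhart–Macdonald reciprocity, the lattice points in the relative interiors of the dilates of
a face of dimension `p` are counted by a polynomial of degree `p` with leading coefficient
`Vol_ℤ / p!`, whose values at negative integers count, up to sign, the lattice points of the closed
dilates. Reciprocity holds for the cone over the face because a generic direction splits this cone
into half-open simplicial cones, each tiled by translates of a half-open box, and reversing the
direction reflects the boxes.

Let `g_p` be the sum of these polynomials over the `p`-dimensional faces. The number `c(P)` is the
alternating sum of `(p + 1)! · lead (g_p)`, and `(p + 1)! · lead (g_p)` is the `(p + 1)`-st finite
difference of `x · g_p(x)`, taken here at points on both sides of `0`. The values at negative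
integers are reexpressed by values at positive ones by splitting closed faces into relative
interiors: in a simple polytope of dimension `n`, a face of dimension `q` lies in
`(n - q).choose (n - p)` faces of dimension `p`. The resulting sums of products of binomial
coefficients are iterated differences of binomial coefficients, hence single binomials.
-/

section HalfOpenSimplex

open Polynomial Set

/-- The polynomial `f` counts `N t` at positive integers `t` and, up to the sign `(-1) ^ p`, counts
`N' t` at `-t`: the shape of the Ehrhart–Macdonald reciprocity law in dimension `p`. -/
structure IsEhrhartPair (p : ℕ) (f : ℝ[X]) (N N' : ℕ → ℕ) : Prop where
  natDegree_le : f.natDegree ≤ p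
  eval_natCast : ∀ t : ℕ, 1 ≤ t → f.eval (t : ℝ) = N t
  eval_neg : ∀ t : ℕ, 1 ≤ t → (-1) ^ p * f.eval (-(t : ℝ)) = N' t

lemma IsEhrhartPair.sum {κ : Type*} {s : Finset κ} {p : ℕ} {f : κ → ℝ[X]} {N N' : κ → ℕ → ℕ}
    (h : ∀ k ∈ s, IsEhrhartPair p (f k) (N k) (N' k)) :
    IsEhrhartPair p (∑ k ∈ s, f k) (fun t => ∑ k ∈ s, N k t) (fun t => ∑ k ∈ s, N' k t) where
  natDegree_le := natDegree_sum_le_of_forall_le _ _ fun k hk => (h k hk).natDegree_le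
  eval_natCast t ht := by
    rw [eval_finsetSum, Nat.cast_sum]
    exact Finset.sum_congr rfl fun k hk => (h k hk).eval_natCast t ht
  eval_neg t ht := by
    rw [eval_finsetSum, Finset.mul_sum, Nat.cast_sum]
    exact Finset.sum_congr rfl fun k hk => (h k hk).eval_neg t ht

lemma eval_preHilbertPoly (p h : ℕ) (x : ℝ) :
    (preHilbertPoly ℝ p h).eval x =
      (p.factorial : ℝ)⁻¹ * (ascPochhammer ℝ p).eval (x - h + 1) := by
  simp [preHilbertPoly]

lemma neg_one_pow_mul_eval_neg_preHilbertPoly {p h h' : ℕ} (hh : h + h' = p + 1) (x : ℝ) :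
    (-1) ^ p * (preHilbertPoly ℝ p h).eval (-x) = (preHilbertPoly ℝ p h').eval x := by
  have hh' : (h : ℝ) + h' = p + 1 := by exact_mod_cast hh
  have hneg : -x - h + 1 = -(x + h - 1) := by ring
  have hshift : x + h - 1 - p + 1 = x - h' + 1 := by linear_combination hh'
  rw [eval_preHilbertPoly, eval_preHilbertPoly, hneg, ascPochhammer_eval_neg_eq_descPochhammer,
    descPochhammer_eval_eq_ascPochhammer, hshift, mul_left_comm, ← mul_assoc ((-1) ^ p), ← mul_pow]
  simp

variable {ι : Type*}

lemma ncard_add_sum_eq [Fintype ι] {p h t : ℕ} (hι : Fintype.card ι = p + 1) (hh : h ≤ p + 1)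
    (ht : 1 ≤ t) :
    ({n : ι → ℕ | h + ∑ i, n i = t}.ncard : ℝ) = (preHilbertPoly ℝ p h).eval (t : ℝ) := by
  classical
  rcases lt_or_ge t h with hlt | hle
  · have hempty : {n : ι → ℕ | h + ∑ i, n i = t} = ∅ :=
      eq_empty_of_forall_notMem fun n hn => by have : h + _ = t := hn; omega
    have harg : (t : ℝ) - h + 1 = -((h - t - 1 : ℕ) : ℝ) := by
      rw [Nat.cast_sub (by omega), Nat.cast_sub hlt.le]
      push_cast
      ring
    rw [hempty, ncard_empty, eval_preHilbertPoly, harg,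
      ascPochhammer_eval_neg_coe_nat_of_lt (by omega)]
    simp
  · have e : {n : ι → ℕ | h + ∑ i, n i = t} ≃ Sym ι (t - h) :=
      (Equiv.subtypeEquivRight fun n => by simp; omega).trans
        (Sym.equivNatSumOfFintype ι (t - h)).symm
    rw [preHilbertPoly_eq_choose_sub_add _ _ hle, ← Nat.card_coe_set_eq, Nat.card_congr e,
      Nat.card_eq_fintype_card, Sym.card_sym_eq_choose, hι, ← Nat.choose_symm_add,
      show p + 1 + (t - h) - 1 = t - h + p by omega]

/-- The orthant with the facets indexed by `O` removed. -/
def halfOpenOrthant (O : Set ι) : Set (ι → ℝ) :=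
  {x | ∀ i, (i ∈ O → 0 < x i) ∧ (i ∉ O → 0 ≤ x i)}

/-- The half-open unit cube whose translates by `ℕ ^ ι` tile `halfOpenOrthant O`: the facet
`x i = 0` is removed for `i ∈ O` and the facet `x i = 1` for `i ∉ O`. -/
def halfOpenBox (O : Set ι) : Set (ι → ℝ) :=
  {x | ∀ i, (i ∈ O → x i ∈ Ioc 0 1) ∧ (i ∉ O → x i ∈ Ico 0 1)}

lemma halfOpenBox_subset_Icc (O : Set ι) : halfOpenBox O ⊆ Icc 0 1 := fun x hx => by
  refine ⟨fun i => ?_, fun i => ?_⟩ <;> by_cases hi : i ∈ O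
  exacts [((hx i).1 hi).1.le, ((hx i).2 hi).1, ((hx i).1 hi).2, ((hx i).2 hi).2.le]

lemma one_sub_mem_halfOpenBox_compl_iff {O : Set ι} {x : ι → ℝ} :
    1 - x ∈ halfOpenBox Oᶜ ↔ x ∈ halfOpenBox O := by
  refine forall_congr' fun i => ?_
  simp only [mem_compl_iff, not_not, Pi.sub_apply, Pi.one_apply, mem_Ioc, mem_Ico, sub_pos,
    sub_nonneg, sub_le_self_iff, sub_lt_self_iff]
  tauto

lemma add_natCast_mem_halfOpenOrthant {O : Set ι} {x : ι → ℝ} (hx : x ∈ halfOpenBox O)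
    (n : ι → ℕ) : x + (n · : ι → ℝ) ∈ halfOpenOrthant O := fun i =>
  ⟨fun hi => add_pos_of_pos_of_nonneg ((hx i).1 hi).1 (Nat.cast_nonneg _),
    fun hi => add_nonneg ((hx i).2 hi).1 (Nat.cast_nonneg _)⟩

lemma exists_sub_natCast_mem_halfOpenBox {O : Set ι} {x : ι → ℝ} (hx : x ∈ halfOpenOrthant O) :
    ∃ n : ι → ℕ, x - (n · : ι → ℝ) ∈ halfOpenBox O := by
  have hcoord : ∀ i, ∃ n : ℕ, (i ∈ O → x i - n ∈ Ioc (0 : ℝ) 1) ∧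
      (i ∉ O → x i - n ∈ Ico (0 : ℝ) 1) := by
    intro i
    by_cases hi : i ∈ O
    · have hpos := (hx i).1 hi
      refine ⟨⌈x i⌉₊ - 1, fun _ => ?_, fun h => absurd hi h⟩
      rw [Nat.cast_sub (Nat.ceil_pos.2 hpos), Nat.cast_one]
      constructor <;> linarith [Nat.ceil_lt_add_one hpos.le, Nat.le_ceil (x i)]
    · refine ⟨⌊x i⌋₊, fun h => absurd h hi, fun _ => ?_⟩
      constructor <;> linarith [Nat.floor_le ((hx i).2 hi), Nat.lt_floor_add_one (x i)]
  choose n hn using hcoord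
  exact ⟨n, hn⟩

lemma eq_of_add_natCast_eq_of_mem_halfOpenBox {O : Set ι} {x y : ι → ℝ} {n m : ι → ℕ}
    (hx : x ∈ halfOpenBox O) (hy : y ∈ halfOpenBox O)
    (h : x + (n · : ι → ℝ) = y + (m · : ι → ℝ)) : x = y := by
  have hnm : n = m := by
    funext i
    have hi : x i + n i = y i + m i := congrFun h i
    have hlt : (n i : ℝ) < m i + 1 ∧ (m i : ℝ) < n i + 1 := by
      by_cases hO : i ∈ O
      · obtain ⟨⟨_, _⟩, _, _⟩ := And.intro ((hx i).1 hO) ((hy i).1 hO)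
        constructor <;> linarith
      · obtain ⟨⟨_, _⟩, _, _⟩ := And.intro ((hx i).2 hO) ((hy i).2 hO)
        constructor <;> linarith
    exact le_antisymm (Nat.lt_succ_iff.1 (by exact_mod_cast hlt.1))
      (Nat.lt_succ_iff.1 (by exact_mod_cast hlt.2))
  simpa [hnm] using h

lemma natCast_mem_of_single_mem [Finite ι] [DecidableEq ι] {Γ : AddSubgroup (ι → ℝ)}
    (hΓ : ∀ i, Pi.single i (1 : ℝ) ∈ Γ) (n : ι → ℕ) : (n · : ι → ℝ) ∈ Γ := by
  have := Fintype.ofFinite ι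
  have hn : (n · : ι → ℝ) = ∑ i, n i • Pi.single i (1 : ℝ) := by
    funext j
    simp [Finset.sum_apply, Pi.single_apply]
  exact hn ▸ sum_mem fun i _ => Γ.nsmul_mem (hΓ i) _

variable [Fintype ι]

lemma ncard_halfOpenOrthant_eq_sum [DecidableEq ι] {p : ℕ} (hι : Fintype.card ι = p + 1)
    {Γ : AddSubgroup (ι → ℝ)} (hΓ : ∀ i, Pi.single i (1 : ℝ) ∈ Γ) {O : Set ι} {B : Finset (ι → ℝ)}
    (hB : ∀ x, x ∈ B ↔ x ∈ Γ ∧ x ∈ halfOpenBox O) {height : (ι → ℝ) → ℕ}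
    (hheight : ∀ x ∈ B, ∑ i, x i = height x) {t : ℕ} (ht : 1 ≤ t) :
    ({x | x ∈ Γ ∧ x ∈ halfOpenOrthant O ∧ ∑ i, x i = t}.ncard : ℝ) =
      ∑ x ∈ B, (preHilbertPoly ℝ p (height x)).eval (t : ℝ) := by
  let tile (x : ι → ℝ) : Set (ι → ℝ) :=
    (fun n : ι → ℕ => x + (n · : ι → ℝ)) '' {n | height x + ∑ i, n i = t}
  have htile : {x | x ∈ Γ ∧ x ∈ halfOpenOrthant O ∧ ∑ i, x i = t} = ⋃ x ∈ (B : Set _), tile x := by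
    ext y
    simp only [mem_ofPred_eq, mem_iUnion₂, Finset.mem_coe]
    constructor
    · rintro ⟨hyΓ, hyO, hyt⟩
      obtain ⟨n, hn⟩ := exists_sub_natCast_mem_halfOpenBox hyO
      have hmem := (hB _).2 ⟨Γ.sub_mem hyΓ (natCast_mem_of_single_mem hΓ n), hn⟩
      refine ⟨_, hmem, n, ?_, sub_add_cancel _ _⟩
      have hsum := hheight _ hmem
      simp only [Pi.sub_apply, Finset.sum_sub_distrib, hyt, sub_eq_iff_eq_add] at hsum
      exact_mod_cast hsum.symm
    · rintro ⟨x, hx, n, hn, rfl⟩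
      obtain ⟨hxΓ, hxO⟩ := (hB x).1 hx
      refine ⟨Γ.add_mem hxΓ (natCast_mem_of_single_mem hΓ n),
        add_natCast_mem_halfOpenOrthant hxO n, ?_⟩
      simp only [Pi.add_apply, Finset.sum_add_distrib, hheight x hx]
      exact_mod_cast hn
  have hdisj : (B : Set (ι → ℝ)).PairwiseDisjoint tile := by
    intro x hx y hy hxy
    refine disjoint_left.2 ?_
    rintro _ ⟨n, -, rfl⟩ ⟨m, -, hm⟩
    exact hxy (eq_of_add_natCast_eq_of_mem_halfOpenBox ((hB x).1 hx).2 ((hB y).1 hy).2 hm.symm)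
  have hfin (x : ι → ℝ) : {n : ι → ℕ | height x + ∑ i, n i = t}.Finite := by
    refine (finite_Iic (fun _ : ι => t)).subset fun n hn i => ?_
    exact ((Finset.single_le_sum_of_canonicallyOrdered (Finset.mem_univ i)).trans
      (Nat.le_add_left _ _)).trans_eq hn
  rw [htile, B.finite_toSet.ncard_biUnion (fun x _ => (hfin x).image _) hdisj,
    finsum_mem_coe_finset, Nat.cast_sum]
  refine Finset.sum_congr rfl fun x hx => ?_
  have hinj : Function.Injective fun n : ι → ℕ => x + (n · : ι → ℝ) := fun n m hnm =>
    funext fun i => by simpa using congrFun hnm i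
  have hle : height x ≤ p + 1 := by
    have hsum : ∑ i, x i ≤ ∑ _i : ι, (1 : ℝ) :=
      Finset.sum_le_sum fun i _ => (halfOpenBox_subset_Icc O ((hB x).1 hx).2).2 i
    rw [hheight x hx, Finset.sum_const, Finset.card_univ, hι, nsmul_eq_mul, mul_one] at hsum
    exact_mod_cast hsum
  rw [ncard_image_of_injective _ hinj, ncard_add_sum_eq hι hle ht]

-- Reciprocity comes from the reflection `x ↦ 1 - x`, which exchanges the two half-open cubes.
theorem exists_isEhrhartPair_halfOpenOrthant {p : ℕ} (hι : Fintype.card ι = p + 1)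
    {Γ : AddSubgroup (ι → ℝ)} [DecidableEq ι] (hΓ : ∀ i, Pi.single i (1 : ℝ) ∈ Γ)
    (hheightInt : ∀ x ∈ Γ, ∃ k : ℤ, ∑ i, x i = k) (hfin : (Γ ∩ Icc (0 : ι → ℝ) 1 : Set _).Finite)
    (O : Set ι) :
    ∃ f : ℝ[X], IsEhrhartPair p f
      (fun t => {x | x ∈ Γ ∧ x ∈ halfOpenOrthant O ∧ ∑ i, x i = t}.ncard)
      (fun t => {x | x ∈ Γ ∧ x ∈ halfOpenOrthant Oᶜ ∧ ∑ i, x i = t}.ncard) := by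
  have hbox (O : Set ι) : {x | x ∈ Γ ∧ x ∈ halfOpenBox O}.Finite :=
    hfin.subset fun x hx => ⟨hx.1, halfOpenBox_subset_Icc O hx.2⟩
  have hB (O : Set ι) (x) : x ∈ (hbox O).toFinset ↔ x ∈ Γ ∧ x ∈ halfOpenBox O :=
    (hbox O).mem_toFinset
  let height (x : ι → ℝ) : ℕ := ⌊∑ i, x i⌋₊
  have hheight (O : Set ι) (x) (hx : x ∈ (hbox O).toFinset) : ∑ i, x i = height x := by
    obtain ⟨hxΓ, hxO⟩ := (hB O x).1 hx
    obtain ⟨k, hk⟩ := hheightInt x hxΓ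
    have hk0 : (0 : ℝ) ≤ k := hk ▸ Finset.sum_nonneg fun i _ => (halfOpenBox_subset_Icc O hxO).1 i
    lift k to ℕ using by exact_mod_cast hk0
    simp [height, hk]
  have hone : (1 : ι → ℝ) ∈ Γ := by simpa [Pi.one_def] using natCast_mem_of_single_mem hΓ fun _ => 1
  refine ⟨∑ x ∈ (hbox O).toFinset, preHilbertPoly ℝ p (height x),
    natDegree_sum_le_of_forall_le _ _ fun x _ => (natDegree_preHilbertPoly ℝ p _).le,
    fun t ht => ?_, fun t ht => ?_⟩
  · rw [ncard_halfOpenOrthant_eq_sum hι hΓ (hB O) (hheight O) ht, eval_finsetSum]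
  · rw [ncard_halfOpenOrthant_eq_sum hι hΓ (hB Oᶜ) (hheight Oᶜ) ht, eval_finsetSum, Finset.mul_sum]
    have hrefl {O : Set ι} {x} (hx : x ∈ (hbox O).toFinset) : 1 - x ∈ (hbox Oᶜ).toFinset :=
      (hB _ _).2 ⟨Γ.sub_mem hone ((hB _ _).1 hx).1,
        one_sub_mem_halfOpenBox_compl_iff.2 ((hB _ _).1 hx).2⟩
    refine Finset.sum_nbij' (1 - ·) (1 - ·) (fun x hx => hrefl hx)
      (fun x hx => by simpa using hrefl hx) (fun x _ => sub_sub_cancel _ _)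
      (fun x _ => sub_sub_cancel _ _) fun x hx => neg_one_pow_mul_eval_neg_preHilbertPoly ?_ _
    have hsum : (height x : ℝ) + height (1 - x) = p + 1 := by
      rw [← hheight _ _ hx, ← hheight _ _ (hrefl hx)]
      simp [hι]
    exact_mod_cast hsum

end HalfOpenSimplex

section LexTriangulation

open Filter Set Topology

section Lex

variable {ι : Type*}

/-- A vector is lexicographically nonnegative along a list of coordinates if its first nonzero
entry along the list, if there is one, is positive. -/
def LexNonneg : List ι → (ι → ℝ) → Prop
  | [], _ => True
  | i :: l, x => 0 < x i ∨ x i = 0 ∧ LexNonneg l x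

lemma LexNonneg.eq_zero {l : List ι} {x : ι → ℝ} (h : LexNonneg l x) (h' : LexNonneg l (-x)) :
    ∀ i ∈ l, x i = 0 := by
  induction l with
  | nil => simp
  | cons j l ih =>
    simp only [LexNonneg, Pi.neg_apply, Left.neg_pos_iff, neg_eq_zero] at h h'
    rcases h with hpos | ⟨hzero, hl⟩ <;> rcases h' with hneg | ⟨hzero', hl'⟩
    · exact absurd hneg hpos.not_gt
    · exact absurd hzero' hpos.ne'
    · exact absurd hzero hneg.ne
    · simpa [hzero] using ih hl hl'

lemma LexNonneg.of_smul {l : List ι} {x : ι → ℝ} {c : ℝ} (hc : 0 < c)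
    (h : LexNonneg l (c • x)) : LexNonneg l x := by
  induction l with
  | nil => trivial
  | cons j l ih =>
    simp only [LexNonneg, Pi.smul_apply, smul_eq_mul, mul_pos_iff_of_pos_left hc, mul_eq_zero,
      hc.ne', false_or] at h ⊢
    exact h.imp_right (And.imp_right ih)

lemma exists_lexMin_of_isCompact (l : List ι) {K : Set (ι → ℝ)} (hK : IsCompact K)
    (hne : K.Nonempty) : ∃ x ∈ K, ∀ y ∈ K, LexNonneg l (y - x) := by
  induction l generalizing K with
  | nil => exact ⟨_, hne.some_mem, fun _ _ => trivial⟩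
  | cons j l ih =>
    obtain ⟨z, hz, hmin⟩ := hK.exists_isMinOn hne (continuous_apply j).continuousOn
    obtain ⟨x, ⟨hxK, hxj⟩, hx⟩ := ih (K := K ∩ {x | x j = z j})
      (hK.inter_right (isClosed_eq (continuous_apply j) continuous_const)) ⟨z, hz, rfl⟩
    refine ⟨x, hxK, fun y hy => ?_⟩
    have hxj : x j = z j := hxj
    have hzy : z j ≤ y j := hmin hy
    simp only [LexNonneg, Pi.sub_apply, sub_pos, sub_eq_zero, hxj]
    exact hzy.lt_or_eq.imp_right fun h => ⟨h.symm, hx y ⟨hy, h.symm⟩⟩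

end Lex

lemma eventually_add_mul_pos {a b : ℝ} (h : 0 < a ∨ a = 0 ∧ 0 < b) :
    ∀ᶠ ε in 𝓝[>] (0 : ℝ), 0 < a + ε * b := by
  rcases h with ha | ⟨rfl, hb⟩
  · have hcont : Continuous fun ε : ℝ => a + ε * b := by fun_prop
    have hlim := (hcont.tendsto 0).mono_left (nhdsWithin_le_nhds (s := Ioi 0))
    exact hlim.eventually_const_lt (by simpa using ha)
  · filter_upwards [self_mem_nhdsWithin] with ε hε
    simpa using mul_pos hε hb

lemma pos_or_of_frequently_add_mul_pos {a b : ℝ} (h : ∃ᶠ ε in 𝓝[>] (0 : ℝ), 0 < a + ε * b) :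
    0 < a ∨ a = 0 ∧ 0 < b := by
  by_contra! hab
  refine h ?_
  rcases hab.1.lt_or_eq with ha | rfl
  · filter_upwards [eventually_add_mul_pos (b := -b) (.inl (neg_pos.2 ha))] with ε hε
    linarith
  · filter_upwards [self_mem_nhdsWithin] with ε hε
    simpa using mul_nonpos_of_nonneg_of_nonpos (le_of_lt hε) (hab.2 rfl)

section EntrySet

variable {V W : Type*} [AddCommGroup V] [Module ℝ V] [AddCommGroup W] [Module ℝ W]

lemma eventually_add_smul_notMem {H : Submodule ℝ V} {e : V} (he : e ∉ H) (y : V) :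
    ∀ᶠ ε in 𝓝[>] (0 : ℝ), y + ε • e ∉ H := by
  by_contra hcon
  have hfreq : ∃ᶠ ε in 𝓝[>] (0 : ℝ), y + ε • e ∈ H := hcon
  obtain ⟨δ, hδ, hδ0⟩ := (hfreq.and_eventually self_mem_nhdsWithin).exists
  obtain ⟨ε, hε, -, hεδ⟩ := (hfreq.and_eventually (Ioo_mem_nhdsGT hδ0)).exists
  have hsub : (ε - δ) • e ∈ H := by simpa [sub_smul] using H.sub_mem hε hδ
  exact he ((H.smul_mem_iff (sub_ne_zero.2 hεδ.ne)).1 hsub)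

/-- The points from which a small step in direction `e` leads into `C`. Applied to the open cells
of a triangulation, this assigns each boundary point to exactly one cell, for generic `e`. -/
def entrySet (C : Set V) (e : V) : Set V := {y | ∀ᶠ ε in 𝓝[>] (0 : ℝ), y + ε • e ∈ C}

lemma mem_entrySet_iff {C : Set V} {e y : V} :
    y ∈ entrySet C e ↔ ∀ᶠ ε in 𝓝[>] (0 : ℝ), y + ε • e ∈ C := Iff.rfl

lemma entrySet_mono {C D : Set V} (h : C ⊆ D) (e : V) : entrySet C e ⊆ entrySet D e :=
  fun _ hy => (mem_entrySet_iff.1 hy).mono fun _ hε => h hε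

lemma disjoint_entrySet {C D : Set V} (h : Disjoint C D) (e : V) :
    Disjoint (entrySet C e) (entrySet D e) :=
  disjoint_left.2 fun _ hC hD => by
    obtain ⟨ε, hεC, hεD⟩ := ((mem_entrySet_iff.1 hC).and (mem_entrySet_iff.1 hD)).exists
    exact disjoint_left.1 h hεC hεD

lemma entrySet_image {T : W →ₗ[ℝ] V} (hT : Function.Injective T) (O : Set W) (b : W) :
    entrySet (T '' O) (T b) = T '' entrySet O b := by
  have hstep (x : W) : T x ∈ entrySet (T '' O) (T b) ↔ x ∈ entrySet O b := by
    simp only [entrySet, mem_ofPred_eq, ← map_smul, ← map_add, hT.mem_set_image]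
  refine Subset.antisymm (fun y hy => ?_) (image_subset_iff.2 fun x hx => (hstep x).2 hx)
  obtain ⟨ε, z, -, hz⟩ := (mem_entrySet_iff.1 hy).exists
  obtain rfl : T (z - ε • b) = y := by simp [hz]
  exact mem_image_of_mem T ((hstep _).1 hy)

lemma mem_entrySet_pos_of_frequently {κ : Type*} [Finite κ] {x b : κ → ℝ}
    (h : ∃ᶠ ε in 𝓝[>] (0 : ℝ), x + ε • b ∈ {c : κ → ℝ | ∀ i, 0 < c i}) :
    x ∈ entrySet {c : κ → ℝ | ∀ i, 0 < c i} b :=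
  eventually_all.2 fun i => eventually_add_mul_pos
    (pos_or_of_frequently_add_mul_pos (h.mono fun _ hε => hε i))

lemma entrySet_pos_eq_halfOpenOrthant {κ : Type*} [Finite κ] {b : κ → ℝ} (hb : ∀ i, b i ≠ 0) :
    entrySet {c : κ → ℝ | ∀ i, 0 < c i} b = halfOpenOrthant {i | b i < 0} := by
  ext x
  have hcoord (i : κ) : (0 < x i ∨ x i = 0 ∧ 0 < b i) ↔
      (i ∈ {i | b i < 0} → 0 < x i) ∧ (i ∉ {i | b i < 0} → 0 ≤ x i) := by
    rcases (hb i).lt_or_gt with h | h <;> simp [h, h.not_gt, le_iff_lt_or_eq, eq_comm]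
  constructor
  · exact fun hx i => (hcoord i).1
      (pos_or_of_frequently_add_mul_pos ((mem_entrySet_iff.1 hx).frequently.mono fun _ hε => hε i))
  · exact fun hx => eventually_all.2 fun i => eventually_add_mul_pos ((hcoord i).2 (hx i))

end EntrySet

section OpenCell

variable {V ι : Type*} [AddCommGroup V] [Module ℝ V] [Fintype ι] {q : ι → V} {A B : Set ι}

lemma mem_hull_range_iff {y : V} :
    y ∈ PointedCone.hull ℝ (range q) ↔ ∃ c : ι → ℝ, (∀ i, 0 ≤ c i) ∧ ∑ i, c i • q i = y := by
  rw [Submodule.mem_span_range_iff_exists_fun]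
  exact ⟨fun ⟨c, hc⟩ => ⟨fun i => c i, fun i => (c i).2, hc⟩,
    fun ⟨c, hc0, hc⟩ => ⟨fun i => ⟨c i, hc0 i⟩, hc⟩⟩

/-- The relatively open cone of the combinations of `q` whose coefficients are positive on `A` and
vanish off `A`. -/
def openCell (q : ι → V) (A : Set ι) : Set V :=
  {y | ∃ c : ι → ℝ, (∀ i, 0 ≤ c i) ∧ (∀ i, 0 < c i ↔ i ∈ A) ∧ ∑ i, c i • q i = y}

lemma openCell_subset_hull : openCell q A ⊆ PointedCone.hull ℝ (range q) :=
  fun _ ⟨c, hc0, _, hc⟩ => mem_hull_range_iff.2 ⟨c, hc0, hc⟩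

lemma mem_openCell_univ_iff {y : V} :
    y ∈ openCell q univ ↔ ∃ c : ι → ℝ, (∀ i, 0 < c i) ∧ ∑ i, c i • q i = y :=
  exists_congr fun _ => ⟨fun ⟨_, hA, hc⟩ => ⟨fun i => (hA i).2 trivial, hc⟩,
    fun ⟨hpos, hc⟩ => ⟨fun i => (hpos i).le, fun i => iff_of_true (hpos i) trivial, hc⟩⟩

lemma exists_sum_smul_eq_sum_coe [Fintype A] (x : A → ℝ) :
    ∃ c : ι → ℝ, (∀ i : A, c i = x i) ∧ (∀ i ∉ A, c i = 0) ∧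
      ∑ i, c i • q i = ∑ i : A, x i • q i := by
  have hcoe (i : A) : Function.extend Subtype.val x 0 i = x i :=
    Subtype.val_injective.extend_apply _ _ _
  have hout (i : ι) (hi : i ∉ A) : Function.extend Subtype.val x 0 i = 0 :=
    Function.extend_apply' _ _ _ (by simpa using hi)
  refine ⟨Function.extend Subtype.val x 0, hcoe, hout, ?_⟩
  exact (Fintype.sum_of_injective (Subtype.val : A → ι) Subtype.val_injective _ _
    (fun i hi => by rw [hout i (by simpa using hi), zero_smul]) fun i => by rw [hcoe]).symm

lemma openCell_eq_image [Fintype A] :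
    openCell q A = Fintype.linearCombination ℝ (fun i : A => q i) '' {x | ∀ i, 0 < x i} := by
  ext y
  constructor
  · rintro ⟨c, hc0, hcA, rfl⟩
    refine ⟨fun i => c i, fun i => (hcA i).2 i.2, ?_⟩
    exact Fintype.sum_of_injective (Subtype.val : A → ι) Subtype.val_injective _ _
      (fun i hi => by
        rw [le_antisymm (not_lt.1 fun h => hi ⟨⟨i, (hcA i).1 h⟩, rfl⟩) (hc0 i), zero_smul])
      fun i => rfl
  · rintro ⟨x, hx, rfl⟩
    obtain ⟨c, hcoe, hout, hsum⟩ := exists_sum_smul_eq_sum_coe (q := q) x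
    have hpos (i : ι) (hi : i ∈ A) : 0 < c i := (hx ⟨i, hi⟩).trans_eq (hcoe ⟨i, hi⟩).symm
    have hA (i : ι) : 0 < c i ↔ i ∈ A :=
      ⟨fun h => by_contra fun hi => h.ne' (hout i hi), hpos i⟩
    exact ⟨c, fun i => (em (i ∈ A)).elim (fun hi => (hpos i hi).le) fun hi => (hout i hi).ge, hA,
      hsum⟩

lemma mem_entrySet_openCell_of_frequently (hA : LinearIndependent ℝ fun i : A => q i)
    {e : V} (he : e ∈ Submodule.span ℝ (q '' A)) {y : V}
    (hy : ∃ᶠ ε in 𝓝[>] (0 : ℝ), y + ε • e ∈ openCell q A) : y ∈ entrySet (openCell q A) e := by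
  have := Fintype.ofFinite A
  have hinj := hA.fintypeLinearCombination_injective
  rw [image_eq_range, ← Fintype.range_linearCombination] at he
  obtain ⟨b, rfl⟩ := he
  rw [openCell_eq_image] at hy ⊢
  obtain ⟨ε, z, -, hz⟩ := hy.exists
  obtain rfl : Fintype.linearCombination ℝ (fun i : A => q i) (z - ε • b) = y := by simp [hz]
  rw [entrySet_image hinj]
  refine mem_image_of_mem _ (mem_entrySet_pos_of_frequently ?_)
  simpa only [← map_smul, ← map_add, hinj.mem_set_image] using hy

lemma sum_smul_mem_hull {w : ι → ℝ} (hw : ∀ i, 0 < w i) :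
    ∑ i, w i • q i ∈ PointedCone.hull ℝ (range q) :=
  mem_hull_range_iff.2 ⟨w, fun i => (hw i).le, rfl⟩

lemma entrySet_hull_neg {w : ι → ℝ} (hw : ∀ i, 0 < w i) :
    entrySet (PointedCone.hull ℝ (range q) : Set V) (-∑ i, w i • q i) = openCell q univ := by
  ext y
  rw [mem_openCell_univ_iff]
  constructor
  · intro hy
    obtain ⟨ε, hmem, hε⟩ := ((mem_entrySet_iff.1 hy).and self_mem_nhdsWithin).exists
    obtain ⟨c, hc0, hc⟩ := mem_hull_range_iff.1 hmem
    refine ⟨fun i => c i + ε * w i,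
      fun i => add_pos_of_nonneg_of_pos (hc0 i) (mul_pos hε (hw i)), ?_⟩
    simp [add_smul, Finset.sum_add_distrib, hc, mul_smul, ← Finset.smul_sum]
  · rintro ⟨c, hc, rfl⟩
    filter_upwards [eventually_all.2 fun i => eventually_add_mul_pos (b := -w i) (.inl (hc i))]
      with ε hε
    refine mem_hull_range_iff.2 ⟨fun i => c i + ε * -w i, fun i => (hε i).le, ?_⟩
    simp [add_smul, Finset.sum_add_distrib, mul_smul, Finset.smul_sum]

end OpenCell

end LexTriangulation

section EhrhartCone

open Filter Polynomial Set Topology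

section MaxCells

variable {V ι : Type*} [AddCommGroup V] [Module ℝ V] [Fintype ι] {q : ι → V} {A B : Set ι} {e : V}

/-- A set `A` of indices supports lexicographically minimal combinations: every linear relation
that is nonnegative off `A` is lexicographically nonnegative. These sets index the cells of a
triangulation of the cone spanned by `q`. -/
def IsLexMinSupport (q : ι → V) (A : Set ι) : Prop :=
  ∀ μ : ι → ℝ, ∑ i, μ i • q i = 0 → (∀ i ∉ A, 0 ≤ μ i) → LexNonneg Finset.univ.toList μ

lemma IsLexMinSupport.eq_zero (hA : IsLexMinSupport q A) (hB : IsLexMinSupport q B) {μ : ι → ℝ}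
    (h : ∑ i, μ i • q i = 0) (hμA : ∀ i ∉ A, 0 ≤ μ i) (hμB : ∀ i ∉ B, μ i ≤ 0) : μ = 0 :=
  funext fun i => (hA μ h hμA).eq_zero
    (hB (-μ) (by simp [h]) fun i hi => neg_nonneg.2 (hμB i hi)) i (by simp)

lemma IsLexMinSupport.linearIndependent (hA : IsLexMinSupport q A) :
    LinearIndependent ℝ fun i : A => q i := by
  have := Fintype.ofFinite A
  refine Fintype.linearIndependent_iff.2 fun g hg i => ?_
  obtain ⟨c, hcoe, hout, hsum⟩ := exists_sum_smul_eq_sum_coe (q := q) g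
  rw [← hcoe, hA.eq_zero hA (hsum.trans hg) (fun i hi => (hout i hi).ge)
    fun i hi => (hout i hi).le, Pi.zero_apply]

lemma IsLexMinSupport.disjoint_openCell (hA : IsLexMinSupport q A) (hB : IsLexMinSupport q B)
    (hAB : A ≠ B) : Disjoint (openCell q A) (openCell q B) := by
  refine disjoint_left.2 ?_
  rintro _ ⟨c, hc0, hcA, rfl⟩ ⟨c', hc0', hcB, hcc'⟩
  have hsub : c' - c = 0 := by
    refine hA.eq_zero hB (by simp [sub_smul, Finset.sum_sub_distrib, hcc'])
      (fun i hi => sub_nonneg.2 ?_) fun i hi => sub_nonpos.2 ?_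
    · exact (not_lt.1 (mt (hcA i).1 hi)).trans (hc0' i)
    · exact (not_lt.1 (mt (hcB i).1 hi)).trans (hc0 i)
  exact hAB (Set.ext fun i => by rw [← hcA, ← hcB, sub_eq_zero.1 hsub])

/-- The direction `e` avoids the span of every subfamily of `q` that does not span everything. -/
def IsGenericDirection (q : ι → V) (e : V) : Prop :=
  e ∈ Submodule.span ℝ (range q) ∧ ∀ A : Set ι,
    Submodule.span ℝ (q '' A) ≠ Submodule.span ℝ (range q) → e ∉ Submodule.span ℝ (q '' A)

lemma IsGenericDirection.neg {κ : Type*} {q : κ → V} (he : IsGenericDirection q e) :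
    IsGenericDirection q (-e) := by
  simpa [IsGenericDirection] using he

/-- The index sets of the maximal cells of the lexicographic triangulation. -/
def maxCells (q : ι → V) : Set (Set ι) :=
  {A | IsLexMinSupport q A ∧ Submodule.span ℝ (q '' A) = Submodule.span ℝ (range q)}

lemma IsGenericDirection.coeff_ne_zero [Fintype A] (he : IsGenericDirection q e)
    (hA : A ∈ maxCells q) {b : A → ℝ} (hb : ∑ i : A, b i • q i = e) (i : A) : b i ≠ 0 := by
  intro hbi
  have himage : q '' (Subtype.val '' ({i}ᶜ : Set A)) = (fun j : A => q j) '' {i}ᶜ :=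
    image_image _ _ _
  have hspan : e ∈ Submodule.span ℝ ((fun j : A => q j) '' {i}ᶜ) := by
    refine hb ▸ sum_mem fun j _ => ?_
    by_cases hj : j = i
    · simp [hj, hbi]
    · exact Submodule.smul_mem _ _ (Submodule.subset_span ⟨j, hj, rfl⟩)
  have hall : Submodule.span ℝ ((fun j : A => q j) '' {i}ᶜ) = Submodule.span ℝ (range q) := by
    by_contra hne
    exact he.2 _ (himage ▸ hne) (himage ▸ hspan)
  exact hA.1.linearIndependent.notMem_span_image (s := {i}ᶜ) (x := i) (by simp)
    (hall ▸ Submodule.subset_span (mem_range_self _))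

lemma exists_sum_smul_notMem_span (q : ι → V) :
    ∃ x : ι → ℝ, ∀ A : Set ι, Submodule.span ℝ (q '' A) ≠ Submodule.span ℝ (range q) →
      ∑ i, x i • q i ∉ Submodule.span ℝ (q '' A) := by
  classical
  let T := Fintype.linearCombination ℝ q
  let 𝒜 : Set (Set ι) := {A | Submodule.span ℝ (q '' A) ≠ Submodule.span ℝ (range q)}
  by_contra! hcon
  refine Subspace.biUnion_ne_univ_of_top_notMem (k := ℝ) (E := ι → ℝ)
    (s := (toFinite 𝒜).toFinset.image fun A => (Submodule.span ℝ (q '' A)).comap T) ?_ ?_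
  · simp only [Finset.mem_image, Finite.mem_toFinset]
    rintro ⟨A, hA, htop⟩
    refine hA (le_antisymm (Submodule.span_mono (image_subset_range _ _)) ?_)
    rw [← Fintype.range_linearCombination, LinearMap.range_le_iff_comap, htop]
  · refine eq_univ_of_forall fun x => ?_
    obtain ⟨A, hA, hx⟩ := hcon x
    simp only [mem_iUnion, Finset.mem_image, Finite.mem_toFinset]
    exact ⟨_, ⟨A, hA, rfl⟩, hx⟩

lemma exists_pos_isGenericDirection (q : ι → V) :
    ∃ w : ι → ℝ, (∀ i, 0 < w i) ∧ IsGenericDirection q (∑ i, w i • q i) := by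
  obtain ⟨x, hx⟩ := exists_sum_smul_notMem_span q
  have hpos : ∀ᶠ ε in 𝓝[>] (0 : ℝ), ∀ i, 0 < 1 + ε * x i :=
    eventually_all.2 fun i => eventually_add_mul_pos (.inl one_pos)
  have hgen : ∀ᶠ ε in 𝓝[>] (0 : ℝ), ∀ A : Set ι,
      Submodule.span ℝ (q '' A) ≠ Submodule.span ℝ (range q) →
        ∑ i, q i + ε • ∑ i, x i • q i ∉ Submodule.span ℝ (q '' A) :=
    eventually_all.2 fun A =>
      eventually_imp_distrib_left.2 fun hA => eventually_add_smul_notMem (hx A hA) _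
  obtain ⟨ε, hε, hε'⟩ := (hpos.and hgen).exists
  have hsum : ∑ i, (1 + ε * x i) • q i = ∑ i, q i + ε • ∑ i, x i • q i := by
    simp [add_smul, Finset.sum_add_distrib, mul_smul, Finset.smul_sum]
  refine ⟨fun i => 1 + ε * x i, hε, ?_, fun A hA => hsum ▸ hε' A hA⟩
  exact sum_mem fun i _ => Submodule.smul_mem _ _ (Submodule.subset_span (mem_range_self i))

end MaxCells

section CoeffLattice

variable {V κ : Type*} [NormedAddCommGroup V] [NormedSpace ℝ V] {q : κ → V} {Λ : AddSubgroup V}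

/-- The lattice of the coefficient vectors of those combinations of `q` that lie in `Λ`. -/
noncomputable def coeffLattice [Fintype κ] (q : κ → V) (Λ : AddSubgroup V) : AddSubgroup (κ → ℝ) :=
  Λ.comap (Fintype.linearCombination ℝ q).toAddMonoidHom

lemma mem_coeffLattice_iff [Fintype κ] {x : κ → ℝ} :
    x ∈ coeffLattice q Λ ↔ ∑ i, x i • q i ∈ Λ := Iff.rfl

lemma finite_coeffLattice_inter_Icc [Fintype κ] (hfin : ∀ R : ℝ, {x | x ∈ Λ ∧ ‖x‖ ≤ R}.Finite)
    (hq : LinearIndependent ℝ q) : (coeffLattice q Λ ∩ Icc (0 : κ → ℝ) 1 : Set _).Finite := by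
  refine ((hfin (∑ i, ‖q i‖)).preimage hq.fintypeLinearCombination_injective.injOn).subset ?_
  rintro x ⟨hx, hx0, hx1⟩
  refine ⟨hx, (norm_sum_le _ _).trans (Finset.sum_le_sum fun i _ => ?_)⟩
  rw [norm_smul, Real.norm_of_nonneg (hx0 i)]
  exact mul_le_of_le_one_left (norm_nonneg _) (hx1 i)

lemma finite_inter_height_eq_inter_hull [Finite κ] {h : V →L[ℝ] ℝ} (hq : ∀ i, h (q i) = 1)
    (hfin : ∀ R : ℝ, {x | x ∈ Λ ∧ ‖x‖ ≤ R}.Finite) (t : ℝ) :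
    {y | y ∈ Λ ∧ h y = t ∧ y ∈ PointedCone.hull ℝ (range q)}.Finite := by
  have := Fintype.ofFinite κ
  refine (hfin (∑ i, t * ‖q i‖)).subset ?_
  rintro y ⟨hy, hyt, hyq⟩
  obtain ⟨c, hc, rfl⟩ := mem_hull_range_iff.1 hyq
  refine ⟨hy, (norm_sum_le _ _).trans (Finset.sum_le_sum fun i _ => ?_)⟩
  have ht : ∑ i, c i = t := by simpa [hq] using hyt
  rw [norm_smul, Real.norm_of_nonneg (hc i), ← ht]
  gcongr
  exact Finset.single_le_sum (fun j _ => hc j) (Finset.mem_univ i)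

end CoeffLattice

variable {V ι : Type*} [NormedAddCommGroup V] [NormedSpace ℝ V] [Fintype ι] {q : ι → V} {A : Set ι}
  {e : V} {h : V →L[ℝ] ℝ}

lemma exists_isLexMinSupport (hq : ∀ i, h (q i) = 1) {y : V}
    (hy : y ∈ PointedCone.hull ℝ (range q)) : ∃ A, IsLexMinSupport q A ∧ y ∈ openCell q A := by
  let K : Set (ι → ℝ) := {c | (∀ i, 0 ≤ c i) ∧ ∑ i, c i • q i = y}
  have hclosed : IsClosed K := by
    have hnonneg : IsClosed {c : ι → ℝ | ∀ i, 0 ≤ c i} := isClosed_Ici (a := (0 : ι → ℝ))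
    exact hnonneg.inter (isClosed_eq (by fun_prop) continuous_const)
  have hbdd : K ⊆ Icc 0 fun _ => h y := by
    rintro c ⟨hc, rfl⟩
    refine ⟨hc, fun i => ?_⟩
    simpa [hq] using Finset.single_le_sum (fun j _ => hc j) (Finset.mem_univ i)
  obtain ⟨c, ⟨hc0, hcy⟩, hmin⟩ := exists_lexMin_of_isCompact Finset.univ.toList
    (isCompact_Icc.of_isClosed_subset hclosed hbdd) (mem_hull_range_iff.1 hy)
  refine ⟨{i | 0 < c i}, fun μ hμ hμ0 => ?_, c, hc0, fun _ => Iff.rfl, hcy⟩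
  have hstep : ∀ᶠ ε in 𝓝[>] (0 : ℝ), ∀ i, 0 ≤ c i + ε * μ i := by
    refine eventually_all.2 fun i => ?_
    by_cases hi : 0 < c i
    · exact (eventually_add_mul_pos (.inl hi)).mono fun _ => le_of_lt
    · filter_upwards [self_mem_nhdsWithin] with ε hε
      exact add_nonneg (hc0 i) (mul_nonneg (le_of_lt hε) (hμ0 i hi))
  obtain ⟨ε, hε, hε0⟩ := (hstep.and self_mem_nhdsWithin).exists
  have hmem : c + ε • μ ∈ K := ⟨hε, by
    simp only [Pi.add_apply, Pi.smul_apply, smul_eq_mul, add_smul, Finset.sum_add_distrib, hcy,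
      mul_smul, ← Finset.smul_sum, hμ, smul_zero, add_zero]⟩
  have hlex := hmin _ hmem
  rw [add_sub_cancel_left] at hlex
  exact hlex.of_smul hε0

lemma entrySet_hull_eq_biUnion (hq : ∀ i, h (q i) = 1) (he : IsGenericDirection q e) :
    entrySet (PointedCone.hull ℝ (range q) : Set V) e =
      ⋃ A ∈ maxCells q, entrySet (openCell q A) e := by
  refine Subset.antisymm (fun y hy => ?_)
    (iUnion₂_subset fun A _ => entrySet_mono openCell_subset_hull e)
  have hgen : ∀ᶠ ε in 𝓝[>] (0 : ℝ), ∀ A : Set ι,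
      Submodule.span ℝ (q '' A) ≠ Submodule.span ℝ (range q) →
        y + ε • e ∉ Submodule.span ℝ (q '' A) :=
    eventually_all.2 fun A =>
      eventually_imp_distrib_left.2 fun hA => eventually_add_smul_notMem (he.2 A hA) y
  have hcell : ∀ᶠ ε in 𝓝[>] (0 : ℝ), ∃ A, A ∈ maxCells q ∧ y + ε • e ∈ openCell q A := by
    filter_upwards [mem_entrySet_iff.1 hy, hgen] with ε hε hε'
    obtain ⟨A, hA, hεA⟩ := exists_isLexMinSupport hq hε
    have := Fintype.ofFinite A
    refine ⟨A, ⟨hA, by_contra fun hne => hε' A hne ?_⟩, hεA⟩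
    rw [openCell_eq_image] at hεA
    rw [image_eq_range, ← Fintype.range_linearCombination]
    exact image_subset_range _ _ hεA
  obtain ⟨A, hfreq⟩ : ∃ A, ∃ᶠ ε in 𝓝[>] (0 : ℝ), A ∈ maxCells q ∧ y + ε • e ∈ openCell q A :=
    frequently_exists.1 hcell.frequently
  obtain ⟨-, hA, -⟩ := hfreq.exists
  exact mem_iUnion₂.2 ⟨A, hA, mem_entrySet_openCell_of_frequently hA.1.linearIndependent
    (hA.2 ▸ he.1) (hfreq.mono fun _ => And.right)⟩

lemma entrySet_openCell_eq_image [Fintype A] (he : IsGenericDirection q e) (hA : A ∈ maxCells q)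
    {b : A → ℝ} (hb : ∑ i : A, b i • q i = e) :
    entrySet (openCell q A) e =
      Fintype.linearCombination ℝ (fun i : A => q i) '' halfOpenOrthant {i | b i < 0} := by
  rw [openCell_eq_image, ← entrySet_pos_eq_halfOpenOrthant (he.coeff_ne_zero hA hb),
    ← entrySet_image hA.1.linearIndependent.fintypeLinearCombination_injective,
    Fintype.linearCombination_apply, hb]

lemma exists_sum_coe_smul_eq [Fintype A] (he : IsGenericDirection q e) (hA : A ∈ maxCells q) :
    ∃ b : A → ℝ, ∑ i : A, b i • q i = e := by
  rw [← Submodule.mem_span_range_iff_exists_fun, ← image_eq_range, hA.2]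
  exact he.1

lemma entrySet_openCell_subset_hull (he : IsGenericDirection q e) (hA : A ∈ maxCells q) :
    entrySet (openCell q A) e ⊆ PointedCone.hull ℝ (range q) := by
  have := Fintype.ofFinite A
  obtain ⟨b, hb⟩ := exists_sum_coe_smul_eq he hA
  rw [entrySet_openCell_eq_image he hA hb]
  rintro _ ⟨x, hx, rfl⟩
  refine sum_mem fun i _ => PointedCone.smul_mem _ ?_
    (PointedCone.subset_hull (mem_range_self _))
  exact (em (b i < 0)).elim (fun hi => ((hx i).1 hi).le) fun hi => (hx i).2 hi

lemma entrySet_hull (hq : ∀ i, h (q i) = 1) {w : ι → ℝ} (hw : ∀ i, 0 < w i)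
    (he : IsGenericDirection q (∑ i, w i • q i)) :
    entrySet (PointedCone.hull ℝ (range q) : Set V) (∑ i, w i • q i) =
      PointedCone.hull ℝ (range q) := by
  refine Subset.antisymm ?_ fun y hy => ?_
  · rw [entrySet_hull_eq_biUnion hq he]
    exact iUnion₂_subset fun A hA => entrySet_openCell_subset_hull he hA
  · filter_upwards [self_mem_nhdsWithin] with ε hε
    exact add_mem hy (PointedCone.smul_mem _ (le_of_lt hε) (sum_smul_mem_hull hw))

variable {Λ : AddSubgroup V}

lemma ncard_entrySet_hull_eq_sum (hq : ∀ i, h (q i) = 1)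
    (hfin : ∀ R : ℝ, {x | x ∈ Λ ∧ ‖x‖ ≤ R}.Finite) (he : IsGenericDirection q e) (t : ℝ) :
    {y | y ∈ Λ ∧ h y = t ∧ y ∈ entrySet (PointedCone.hull ℝ (range q) : Set V) e}.ncard =
      ∑ A ∈ (toFinite (maxCells q)).toFinset,
        {y | y ∈ Λ ∧ h y = t ∧ y ∈ entrySet (openCell q A) e}.ncard := by
  have hunion : {y | y ∈ Λ ∧ h y = t ∧ y ∈ entrySet (PointedCone.hull ℝ (range q) : Set V) e} =
      ⋃ A ∈ maxCells q, {y | y ∈ Λ ∧ h y = t ∧ y ∈ entrySet (openCell q A) e} := by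
    rw [entrySet_hull_eq_biUnion hq he]
    ext y
    simp only [mem_ofPred_eq, mem_iUnion₂]
    tauto
  have hdisj : (maxCells q).PairwiseDisjoint
      fun A => {y | y ∈ Λ ∧ h y = t ∧ y ∈ entrySet (openCell q A) e} := fun A hA B hB hAB =>
    (disjoint_entrySet (hA.1.disjoint_openCell hB.1 hAB) e).mono (fun _ hy => hy.2.2)
      fun _ hy => hy.2.2
  rw [hunion, (toFinite _).ncard_biUnion (fun A hA => ?_) hdisj,
    finsum_mem_eq_finite_toFinset_sum _ (toFinite _)]
  exact (finite_inter_height_eq_inter_hull hq hfin t).subset fun y hy =>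
    ⟨hy.1, hy.2.1, entrySet_openCell_subset_hull he hA hy.2.2⟩

lemma ncard_entrySet_openCell [Fintype A] (hq : ∀ i, h (q i) = 1) (he : IsGenericDirection q e)
    (hA : A ∈ maxCells q) {b : A → ℝ} (hb : ∑ i : A, b i • q i = e) (t : ℝ) :
    {y | y ∈ Λ ∧ h y = t ∧ y ∈ entrySet (openCell q A) e}.ncard =
      {x | x ∈ coeffLattice (fun i : A => q i) Λ ∧ x ∈ halfOpenOrthant {i | b i < 0} ∧
        ∑ i, x i = t}.ncard := by
  rw [← ncard_image_of_injective _ hA.1.linearIndependent.fintypeLinearCombination_injective,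
    entrySet_openCell_eq_image he hA hb]
  have hheight (x : A → ℝ) : h (Fintype.linearCombination ℝ (fun i : A => q i) x) = ∑ i, x i := by
    simp [Fintype.linearCombination_apply, hq]
  congr 1
  ext y
  constructor
  · rintro ⟨hyΛ, hyt, x, hx, rfl⟩
    exact ⟨x, ⟨hyΛ, hx, by rwa [← hheight]⟩, rfl⟩
  · rintro ⟨x, ⟨hxΛ, hx, hxt⟩, rfl⟩
    exact ⟨hxΛ, by rwa [hheight], x, hx, rfl⟩

lemma exists_isEhrhartPair_openCell (hq : ∀ i, h (q i) = 1) (hqΛ : ∀ i, q i ∈ Λ)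
    (hΛ : ∀ x ∈ Λ, ∃ k : ℤ, h x = k) (hfin : ∀ R : ℝ, {x | x ∈ Λ ∧ ‖x‖ ≤ R}.Finite) {p : ℕ}
    (hp : Module.finrank ℝ (Submodule.span ℝ (range q)) = p + 1) (he : IsGenericDirection q e)
    (hA : A ∈ maxCells q) :
    ∃ f : ℝ[X], IsEhrhartPair p f
      (fun t => {y | y ∈ Λ ∧ h y = t ∧ y ∈ entrySet (openCell q A) e}.ncard)
      (fun t => {y | y ∈ Λ ∧ h y = t ∧ y ∈ entrySet (openCell q A) (-e)}.ncard) := by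
  classical
  have := Fintype.ofFinite A
  obtain ⟨b, hb⟩ := exists_sum_coe_smul_eq he hA
  have hcard : Fintype.card A = p + 1 := by
    rw [← hp, ← hA.2, image_eq_range, finrank_span_eq_card hA.1.linearIndependent]
  have hcompl : {i | b i < 0}ᶜ = {i | (-b) i < 0} := by
    ext i
    simpa using (he.coeff_ne_zero hA hb i).symm.le_iff_lt
  obtain ⟨f, hf⟩ := exists_isEhrhartPair_halfOpenOrthant hcard
    (Γ := coeffLattice (fun i : A => q i) Λ)
    (fun i => mem_coeffLattice_iff.2 (by simpa [Pi.single_apply, ite_smul] using hqΛ i))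
    (fun x hx => by simpa [hq] using hΛ _ (mem_coeffLattice_iff.1 hx))
    (finite_coeffLattice_inter_Icc hfin hA.1.linearIndependent) {i | b i < 0}
  refine ⟨f, ?_⟩
  convert hf using 2 with t t
  · exact ncard_entrySet_openCell hq he hA hb t
  · rw [hcompl]
    exact ncard_entrySet_openCell hq he.neg hA (by simp [hb]) t

theorem exists_isEhrhartPair_hull (hq : ∀ i, h (q i) = 1) (hqΛ : ∀ i, q i ∈ Λ)
    (hΛ : ∀ x ∈ Λ, ∃ k : ℤ, h x = k) (hfin : ∀ R : ℝ, {x | x ∈ Λ ∧ ‖x‖ ≤ R}.Finite) {p : ℕ}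
    (hp : Module.finrank ℝ (Submodule.span ℝ (range q)) = p + 1) :
    ∃ f : ℝ[X], IsEhrhartPair p f
      (fun t => {y | y ∈ Λ ∧ h y = t ∧ y ∈ PointedCone.hull ℝ (range q)}.ncard)
      (fun t => {y | y ∈ Λ ∧ h y = t ∧ y ∈ openCell q univ}.ncard) := by
  obtain ⟨w, hw, he⟩ := exists_pos_isGenericDirection q
  have hcell (A) (hA : A ∈ (toFinite (maxCells q)).toFinset) :=
    exists_isEhrhartPair_openCell hq hqΛ hΛ hfin hp he ((Finite.mem_toFinset _).1 hA)
  choose! f hf using hcell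
  refine ⟨∑ A ∈ (toFinite (maxCells q)).toFinset, f A, ?_⟩
  convert IsEhrhartPair.sum hf using 2 with t t
  · simpa only [entrySet_hull hq hw he, SetLike.mem_coe] using
      ncard_entrySet_hull_eq_sum hq hfin he t
  · simpa only [entrySet_hull_neg hw] using ncard_entrySet_hull_eq_sum hq hfin he.neg t

end EhrhartCone

section RelativeInterior

open Filter Set Topology

variable {E : Type*} [NormedAddCommGroup E] [NormedSpace ℝ E] {G : Set E} {x : E}

lemma exists_mem_interior_preimage_add {z : E} (hx : x ∈ G) (hz : z ∈ intrinsicInterior ℝ G) :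
    ∃ w : vectorSpan ℝ G, x + w = z ∧ w ∈ interior {w : vectorSpan ℝ G | x + (w : E) ∈ G} := by
  obtain ⟨y, hy, rfl⟩ := hz
  have hxa : x ∈ affineSpan ℝ G := subset_affineSpan ℝ G hx
  let φ : vectorSpan ℝ G → affineSpan ℝ G := fun w => ⟨x + w, by
    rw [add_comm]
    exact AffineSubspace.vadd_mem_of_mem_direction
      (by rw [direction_affineSpan]; exact w.2) hxa⟩
  have hφ : Continuous φ := by fun_prop
  have hyx : (y : E) - x ∈ vectorSpan ℝ G := by
    rw [← direction_affineSpan]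
    exact AffineSubspace.vsub_mem_direction y.2 hxa
  have hφy : φ ⟨(y : E) - x, hyx⟩ = y := Subtype.ext (by simp [φ])
  refine ⟨⟨(y : E) - x, hyx⟩, by simp, ?_⟩
  refine preimage_interior_subset_interior_preimage (t := ((↑) ⁻¹' G : Set (affineSpan ℝ G))) hφ ?_
  rwa [mem_preimage, hφy]

lemma mem_intrinsicInterior_of_zero_mem_interior (hx : x ∈ G)
    (h0 : (0 : vectorSpan ℝ G) ∈ interior {w : vectorSpan ℝ G | x + (w : E) ∈ G}) :
    x ∈ intrinsicInterior ℝ G := by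
  have hxa : x ∈ affineSpan ℝ G := subset_affineSpan ℝ G hx
  let ψ : affineSpan ℝ G → vectorSpan ℝ G := fun a => ⟨(a : E) - x, by
    rw [← direction_affineSpan]
    exact AffineSubspace.vsub_mem_direction a.2 hxa⟩
  have hψ : Continuous ψ := by fun_prop
  have hψx : ψ ⟨x, hxa⟩ = 0 := Subtype.ext (by simp [ψ])
  refine ⟨⟨x, hxa⟩, ?_, rfl⟩
  convert preimage_interior_subset_interior_preimage hψ (mem_preimage.2 (hψx ▸ h0)) using 2
  ext a
  simp [ψ]

lemma convex_preimage_add_coe (hG : Convex ℝ G) (W : Submodule ℝ E) (x : E) :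
    Convex ℝ {w : W | x + (w : E) ∈ G} :=
  (hG.translate_preimage_right x).linear_preimage W.subtype

variable [FiniteDimensional ℝ E]

lemma exists_support_of_notMem_intrinsicInterior (hG : Convex ℝ G) (hx : x ∈ G)
    (hxi : x ∉ intrinsicInterior ℝ G) :
    ∃ l : E →L[ℝ] ℝ, (∀ y ∈ G, l y ≤ l x) ∧ ∃ y ∈ G, l y < l x := by
  set G' : Set (vectorSpan ℝ G) := {w | x + (w : E) ∈ G} with hG'
  have hconv : Convex ℝ G' := convex_preimage_add_coe hG _ x
  have h0 : (0 : vectorSpan ℝ G) ∉ interior G' := fun h =>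
    hxi (mem_intrinsicInterior_of_zero_mem_interior hx h)
  obtain ⟨z, hz⟩ := Set.Nonempty.intrinsicInterior hG ⟨x, hx⟩
  obtain ⟨w, rfl, hw⟩ := exists_mem_interior_preimage_add hx hz
  obtain ⟨f, hf⟩ := geometric_hahn_banach_open_point hconv.interior isOpen_interior h0
  obtain ⟨g, hg, -⟩ := exists_extension_norm_eq _ f
  rw [map_zero] at hf
  have hle : ∀ v ∈ G', f v ≤ 0 := by
    have hsub : closure (interior G') ⊆ {v | f v ≤ 0} :=
      closure_minimal (fun v hv => (hf v hv).le) (isClosed_le f.continuous continuous_const)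
    rw [hconv.closure_interior_eq_closure_of_nonempty_interior ⟨w, hw⟩] at hsub
    exact fun v hv => hsub (subset_closure hv)
  refine ⟨g, fun y hy => ?_, x + w, intrinsicInterior_subset hz, ?_⟩
  · have hyx := hle ⟨y - x, vsub_mem_vectorSpan ℝ hy hx⟩ (by simpa [hG'] using hy)
    rwa [← hg, map_sub, sub_nonpos] at hyx
  · simpa [← hg] using hf w hw

lemma mem_intrinsicInterior_iff (hG : Convex ℝ G) :
    x ∈ intrinsicInterior ℝ G ↔ x ∈ G ∧ ∀ y ∈ G, ∃ ε > (0 : ℝ), x + ε • (x - y) ∈ G := by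
  constructor
  · intro hx
    have hxG := intrinsicInterior_subset hx
    refine ⟨hxG, fun y hy => ?_⟩
    obtain ⟨w, hw, hw'⟩ := exists_mem_interior_preimage_add hxG hx
    obtain rfl : w = 0 := Subtype.ext (by simpa using hw)
    let v : vectorSpan ℝ G := ⟨x - y, vsub_mem_vectorSpan ℝ hxG hy⟩
    have hlim : Tendsto (fun ε : ℝ => ε • v) (𝓝[>] 0) (𝓝 0) :=
      tendsto_nhdsWithin_of_tendsto_nhds (Continuous.tendsto' (by fun_prop) 0 0 (zero_smul ℝ v))
    obtain ⟨ε, hε, hε0⟩ :=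
      ((hlim.eventually (mem_interior_iff_mem_nhds.1 hw')).and self_mem_nhdsWithin).exists
    exact ⟨ε, hε0, hε⟩
  · rintro ⟨hxG, h⟩
    by_contra hx
    obtain ⟨l, hl, y, hy, hly⟩ := exists_support_of_notMem_intrinsicInterior hG hxG hx
    obtain ⟨ε, hε, hmem⟩ := h y hy
    have hle := hl _ hmem
    rw [map_add, map_smul, map_sub, smul_eq_mul] at hle
    linarith [mul_pos hε (sub_pos.2 hly)]

lemma smul_mem_intrinsicInterior_smul_iff (hG : Convex ℝ G) {r : ℝ} (hr : 0 < r) :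
    r • x ∈ intrinsicInterior ℝ (r • G) ↔ x ∈ intrinsicInterior ℝ G := by
  have hsmul (ε : ℝ) (y : E) : r • x + ε • (r • x - r • y) = r • (x + ε • (x - y)) := by module
  rw [mem_intrinsicInterior_iff hG, mem_intrinsicInterior_iff (hG.smul r)]
  simp only [← image_smul, forall_mem_image]
  simp only [image_smul, hsmul, smul_mem_smul_set_iff₀ hr.ne']

end RelativeInterior

section EhrhartPolytope

open Filter Polynomial Set Topology

lemma finite_intCast_abs_le (R : ℝ) : {x : ℝ | (∃ k : ℤ, (k : ℝ) = x) ∧ |x| ≤ R}.Finite := by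
  refine ((finite_Icc ⌈-R⌉ ⌊R⌋).image ((↑) : ℤ → ℝ)).subset ?_
  rintro _ ⟨⟨k, rfl⟩, hk⟩
  exact ⟨k, ⟨Int.ceil_le.2 (abs_le.1 hk).1, Int.le_floor.2 (abs_le.1 hk).2⟩, rfl⟩

lemma finite_intLattice_norm_le (d : ℕ) (R : ℝ) :
    {x : Fin d → ℝ | x ∈ intLattice d ∧ ‖x‖ ≤ R}.Finite :=
  (Set.Finite.pi' fun _ : Fin d => finite_intCast_abs_le R).subset fun _ hx j =>
    ⟨hx.1 j, (norm_le_pi_norm _ j).trans hx.2⟩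

/-- The lattice `ℤ^d × ℤ` in which the cone over a lattice polytope lives. -/
def homLattice (d : ℕ) : AddSubgroup ((Fin d → ℝ) × ℝ) :=
  (intLattice d).toAddSubgroup.prod (Int.castAddHom ℝ).range

lemma mem_homLattice_iff {d : ℕ} {y : (Fin d → ℝ) × ℝ} :
    y ∈ homLattice d ↔ y.1 ∈ intLattice d ∧ ∃ k : ℤ, (k : ℝ) = y.2 :=
  Iff.rfl

lemma finite_homLattice_norm_le (d : ℕ) (R : ℝ) : {y | y ∈ homLattice d ∧ ‖y‖ ≤ R}.Finite :=
  ((finite_intLattice_norm_le d R).prod (finite_intCast_abs_le R)).subset fun y hy =>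
    ⟨⟨hy.1.1, (norm_fst_le y).trans hy.2⟩, hy.1.2, (norm_snd_le y).trans hy.2⟩

section HomPoint

variable {E : Type*} [AddCommGroup E] [Module ℝ E]

/-- The generators of the cone over the convex hull of `S`, placed at height `1`. -/
def homPoint (S : Finset E) : S → E × ℝ := fun s => (s, 1)

lemma sum_smul_homPoint {S : Finset E} (c : S → ℝ) :
    ∑ i, c i • homPoint S i = (∑ i, c i • (i : E), ∑ i, c i) := by
  simp [homPoint, Prod.ext_iff, Prod.fst_sum, Prod.snd_sum]

lemma mem_hull_homPoint_iff {S : Finset E} {x : E} {r : ℝ} (hr : 0 < r) :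
    (x, r) ∈ PointedCone.hull ℝ (range (homPoint S)) ↔ x ∈ r • convexHull ℝ (S : Set E) := by
  simp only [mem_hull_range_iff, sum_smul_homPoint, Prod.mk.injEq]
  constructor
  · rintro ⟨c, hc, rfl, rfl⟩
    refine ⟨Finset.univ.centerMass c fun i : S => (i : E), ?_, smul_inv_smul₀ hr.ne' _⟩
    exact Finset.univ.centerMass_mem_convexHull (fun i _ => hc i) hr fun i _ => i.2
  · rintro ⟨y, hy, rfl⟩
    obtain ⟨w, hw, hw1, rfl⟩ := Finset.mem_convexHull'.1 hy
    refine ⟨fun i => r * w i, fun i => mul_nonneg hr.le (hw i i.2), ?_, ?_⟩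
    · simp only [mul_smul, ← Finset.smul_sum, S.sum_coe_sort fun y => w y • y]
    · rw [← Finset.mul_sum, S.sum_coe_sort, hw1, mul_one]

lemma finrank_span_homPoint [FiniteDimensional ℝ E] {S : Finset E} (hS : S.Nonempty) :
    Module.finrank ℝ (Submodule.span ℝ (range (homPoint S))) =
      Module.finrank ℝ (vectorSpan ℝ (S : Set E)) + 1 := by
  obtain ⟨s₀, hs₀⟩ := hS
  let H : Submodule ℝ (E × ℝ) := (vectorSpan ℝ (S : Set E)).map (LinearMap.inl ℝ E ℝ)
  have hspan : Submodule.span ℝ (range (homPoint S)) = H ⊔ Submodule.span ℝ {(s₀, 1)} := by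
    have hmem {s : E} (hs : s ∈ S) : (s, (1 : ℝ)) ∈ Submodule.span ℝ (range (homPoint S)) :=
      Submodule.subset_span ⟨⟨s, hs⟩, rfl⟩
    apply le_antisymm
    · rw [Submodule.span_le]
      rintro _ ⟨s, rfl⟩
      exact Submodule.mem_sup.2 ⟨(s - s₀, 0), ⟨_, vsub_mem_vectorSpan ℝ s.2 hs₀, rfl⟩, (s₀, 1),
        Submodule.mem_span_singleton_self _, by simp [homPoint]⟩
    · refine sup_le ?_ ((Submodule.span_singleton_le_iff_mem _ _).2 (hmem hs₀))
      simp only [H, vectorSpan_eq_span_vsub_set_right ℝ (Finset.mem_coe.2 hs₀), Submodule.map_span,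
        Submodule.span_le, image_image, image_subset_iff]
      exact fun s hs => by simpa using sub_mem (hmem hs) (hmem hs₀)
  have hH : (s₀, (1 : ℝ)) ∉ H := by simp [H]
  rw [hspan, Submodule.finrank_sup_span_singleton hH,
    (Submodule.equivMapOfInjective (LinearMap.inl ℝ E ℝ) LinearMap.inl_injective _).finrank_eq]

end HomPoint

lemma mem_openCell_homPoint_iff {E : Type*} [NormedAddCommGroup E] [NormedSpace ℝ E]
    [FiniteDimensional ℝ E] {S : Finset E} {x : E} {r : ℝ} (hr : 0 < r) :
    (x, r) ∈ openCell (homPoint S) univ ↔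
      x ∈ intrinsicInterior ℝ (r • convexHull ℝ (S : Set E)) := by
  rw [mem_intrinsicInterior_iff ((convex_convexHull ℝ _).smul r)]
  simp only [← mem_hull_homPoint_iff hr]
  simp only [mem_hull_range_iff, mem_openCell_univ_iff, sum_smul_homPoint, Prod.mk.injEq]
  constructor
  · rintro ⟨c, hc, rfl, hcr⟩
    refine ⟨⟨c, fun i => (hc i).le, rfl, hcr⟩, ?_⟩
    rintro _ ⟨c', -, rfl, hcr'⟩
    have hpos : ∀ᶠ ε in 𝓝[>] (0 : ℝ), ∀ i, 0 < c i + ε * (c i - c' i) :=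
      eventually_all.2 fun i => eventually_add_mul_pos (.inl (hc i))
    obtain ⟨ε, hε, hε0⟩ := (hpos.and self_mem_nhdsWithin).exists
    refine ⟨ε, hε0, fun i => c i + ε * (c i - c' i), fun i => (hε i).le, ?_, ?_⟩
    · simp only [add_smul, mul_smul, sub_smul, Finset.sum_add_distrib, ← Finset.smul_sum,
        Finset.sum_sub_distrib]
    · simp only [Finset.sum_add_distrib, ← Finset.mul_sum, Finset.sum_sub_distrib, hcr, hcr',
        sub_self, mul_zero, add_zero]
  · rintro ⟨⟨c, -, -, hcr⟩, h⟩
    have hcard : (0 : ℝ) < Fintype.card S := by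
      refine Nat.cast_pos.2 (Fintype.card_pos_iff.2 ?_)
      by_contra hempty
      rw [not_nonempty_iff] at hempty
      simp [hr.ne] at hcr
    let a : ℝ := r / Fintype.card S
    have ha : 0 < a := div_pos hr hcard
    have har : ∑ _i : S, a = r := by
      simp only [Finset.sum_const, Finset.card_univ, nsmul_eq_mul, a, mul_div_cancel₀ _ hcard.ne']
    obtain ⟨ε, hε, c', hc', hcx, hcr'⟩ := h _ ⟨fun _ => a, fun _ => ha.le, rfl, har⟩
    have hε1 : 0 < 1 + ε := by positivity
    refine ⟨fun i => (1 + ε)⁻¹ * (c' i + ε * a),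
      fun i => mul_pos (inv_pos.2 hε1) (add_pos_of_nonneg_of_pos (hc' i) (mul_pos hε ha)), ?_, ?_⟩
    · simp only [mul_smul, add_smul, Finset.sum_add_distrib, ← Finset.smul_sum, hcx]
      rw [inv_smul_eq_iff₀ hε1.ne']
      module
    · rw [← Finset.mul_sum, Finset.sum_add_distrib, ← Finset.mul_sum, hcr', har]
      field_simp

lemma ncard_homLattice_eq {d t : ℕ} {Q : Set ((Fin d → ℝ) × ℝ)} {R : Set (Fin d → ℝ)}
    (h : ∀ x, (x, (t : ℝ)) ∈ Q ↔ x ∈ R) :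
    {y | y ∈ homLattice d ∧ y.2 = t ∧ y ∈ Q}.ncard = {x | x ∈ intLattice d ∧ x ∈ R}.ncard := by
  rw [← ncard_image_of_injective {x | x ∈ intLattice d ∧ x ∈ R} (Prod.mk_left_injective (t : ℝ))]
  congr 1
  ext ⟨x, r⟩
  simp only [mem_ofPred_eq, mem_homLattice_iff, mem_image, Prod.mk.injEq]
  constructor
  · rintro ⟨⟨hx, -⟩, rfl, hxQ⟩
    exact ⟨x, ⟨hx, (h x).1 hxQ⟩, rfl, rfl⟩
  · rintro ⟨x, ⟨hx, hxR⟩, rfl, rfl⟩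
    exact ⟨⟨hx, t, by simp⟩, rfl, (h x).2 hxR⟩

theorem exists_isEhrhartPair_convexHull {d p : ℕ} {S : Finset (Fin d → ℝ)} (hne : S.Nonempty)
    (hS : ∀ s ∈ S, s ∈ intLattice d) (hp : polyDim (convexHull ℝ (S : Set (Fin d → ℝ))) = p) :
    ∃ f : ℝ[X], IsEhrhartPair p f
      (fun t => {x | x ∈ intLattice d ∧
        x ∈ (t : ℝ) • convexHull ℝ (S : Set (Fin d → ℝ))}.ncard)
      (fun t => {x | x ∈ intLattice d ∧
        x ∈ intrinsicInterior ℝ ((t : ℝ) • convexHull ℝ (S : Set (Fin d → ℝ)))}.ncard) := by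
  have hrank : Module.finrank ℝ (Submodule.span ℝ (range (homPoint S))) = p + 1 := by
    rw [finrank_span_homPoint hne, ← hp, polyDim, ← direction_affineSpan, ← direction_affineSpan,
      affineSpan_convexHull]
  obtain ⟨f, hf⟩ := exists_isEhrhartPair_hull (h := ContinuousLinearMap.snd ℝ (Fin d → ℝ) ℝ)
    (q := homPoint S) (Λ := homLattice d) (fun _ => rfl)
    (fun i => mem_homLattice_iff.2 ⟨hS _ i.2, 1, by simp [homPoint]⟩)
    (fun x hx => (mem_homLattice_iff.1 hx).2.imp fun _ hk => hk.symm)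
    (finite_homLattice_norm_le d) hrank
  refine ⟨f, hf.natDegree_le, fun t ht => ?_, fun t ht => ?_⟩
  · rw [hf.eval_natCast t ht]
    exact congrArg _ (ncard_homLattice_eq fun x => mem_hull_homPoint_iff (by exact_mod_cast ht))
  · rw [hf.eval_neg t ht]
    exact congrArg _ (ncard_homLattice_eq fun x => mem_openCell_homPoint_iff (by exact_mod_cast ht))

end EhrhartPolytope

section FacesOfPolytopes

open Filter Set

section Exposed

variable {E : Type*} [NormedAddCommGroup E] [NormedSpace ℝ E] {S P F G : Set E}

lemma extreme_eq_convexHull_inter (hF : IsExtreme ℝ (convexHull ℝ S) F) (hFc : Convex ℝ F) :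
    F = convexHull ℝ (S ∩ F) := by
  refine Subset.antisymm (fun x hx => ?_) (convexHull_min inter_subset_right hFc)
  have hdiff : convexHull ℝ (S \ F) ⊆ convexHull ℝ S \ F :=
    convexHull_min (sdiff_subset_sdiff_left (subset_convexHull ℝ S))
      (hF.convex_sdiff (convex_convexHull ℝ S))
  rcases (S ∩ F).eq_empty_or_nonempty with hempty | hne
  · have hSF : S \ F = S := by rw [← sdiff_inter_self_eq_sdiff, inter_comm, hempty, sdiff_empty]
    exact absurd hx (hdiff (hSF.symm ▸ hF.1 hx)).2
  rcases (S \ F).eq_empty_or_nonempty with hempty | hne'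
  · rw [inter_eq_left.2 (sdiff_eq_empty.1 hempty)]
    exact hF.1 hx
  have hxS := hF.1 hx
  rw [← inter_union_sdiff S F, convexHull_union hne hne', mem_convexJoin] at hxS
  obtain ⟨a, ha, b, hb, hab⟩ := hxS
  rw [← insert_endpoints_openSegment] at hab
  rcases hab with rfl | rfl | hab
  · exact ha
  · exact absurd hx (hdiff hb).2
  · exact absurd (hF.right_mem_of_mem_openSegment (convexHull_mono inter_subset_left ha)
      (hdiff hb).1 hx hab) (hdiff hb).2

lemma exposed_eq_convexHull_inter (hF : IsExposed ℝ (convexHull ℝ S) F) :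
    F = convexHull ℝ (S ∩ F) :=
  extreme_eq_convexHull_inter hF.isExtreme (hF.convex (convex_convexHull ℝ S))

lemma finite_exposed (hS : S.Finite) : {F | IsExposed ℝ (convexHull ℝ S) F}.Finite :=
  (hS.finite_subsets.image (convexHull ℝ)).subset fun F hF =>
    ⟨S ∩ F, inter_subset_left, (exposed_eq_convexHull_inter hF).symm⟩

lemma exists_support_of_isExposed (hF : IsExposed ℝ P F) {x : E} (hx : x ∈ F) :
    ∃ l : E →L[ℝ] ℝ, (∀ y ∈ P, l y ≤ l x) ∧ ∀ y, y ∈ F ↔ y ∈ P ∧ l y = l x := by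
  obtain ⟨l, rfl⟩ := hF ⟨x, hx⟩
  exact ⟨l, hx.2, fun y => ⟨fun hy => ⟨hy.1, (hx.2 y hy.1).antisymm (hy.2 x hx.1)⟩,
    fun hy => ⟨hy.1, fun z hz => hy.2 ▸ hx.2 z hz⟩⟩⟩

lemma isExposed_of_support {l : E →L[ℝ] ℝ} {x : E} (hx : x ∈ P) (hl : ∀ y ∈ P, l y ≤ l x) :
    IsExposed ℝ P {y | y ∈ P ∧ l y = l x} := fun _ =>
  ⟨l, Set.ext fun _ => ⟨fun hy => ⟨hy.1, fun z hz => hy.2 ▸ hl z hz⟩,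
    fun hy => ⟨hy.1, (hl _ hy.1).antisymm (hy.2 x hx)⟩⟩⟩

lemma le_of_mem_convexHull {l : E →L[ℝ] ℝ} {c : ℝ} (h : ∀ s ∈ S, l s ≤ c) {x : E}
    (hx : x ∈ convexHull ℝ S) : l x ≤ c :=
  convexHull_min (t := {y | l y ≤ c}) h (convex_halfSpace_le l.toLinearMap.isLinear c) hx

lemma exists_forall_lt_mul {ι : Type*} {s : Set ι} (hs : s.Finite) {a b : ι → ℝ}
    (hb : ∀ i ∈ s, 0 < b i) : ∃ N : ℝ, ∀ i ∈ s, a i < N * b i := by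
  have hev : ∀ᶠ N : ℝ in atTop, ∀ i ∈ s, a i / b i < N :=
    (eventually_all_finite hs).2 fun i _ => eventually_gt_atTop _
  obtain ⟨N, hN⟩ := hev.exists
  exact ⟨N, fun i hi => (div_lt_iff₀ (hb i hi)).1 (hN i hi)⟩

-- If `l` exposes `F` in the polytope and `l'` exposes `G` in `F`, then `N • l + l'` exposes `G` in
-- the polytope for large `N`.
lemma isExposed_trans_of_finite (hS : S.Finite) (hF : IsExposed ℝ (convexHull ℝ S) F)
    (hG : IsExposed ℝ F G) : IsExposed ℝ (convexHull ℝ S) G := by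
  rcases G.eq_empty_or_nonempty with rfl | ⟨g, hg⟩
  · exact isExposed_empty
  have hgF := hG.subset hg
  obtain ⟨l, hlP, hl⟩ := exists_support_of_isExposed hF hgF
  obtain ⟨l', hl'F, hl'⟩ := exists_support_of_isExposed hG hg
  obtain ⟨N, hN⟩ := exists_forall_lt_mul (hS.sdiff (t := F)) (a := fun s => l' s - l' g)
    (b := fun s => l g - l s) fun s hs => sub_pos.2 <|
      have hsP := subset_convexHull ℝ S hs.1
      (hlP s hsP).lt_of_ne fun h => hs.2 ((hl s).2 ⟨hsP, h⟩)
  have hm (y : E) : (N • l + l') y = N * l y + l' y := rfl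
  have hmF {y : E} (hy : y ∈ F) : (N • l + l') y = (N • l + l') g ↔ l' y = l' g := by
    rw [hm, hm, ((hl y).1 hy).2, add_right_inj]
  have hmS (s) (hs : s ∈ S) (hsF : s ∉ F) : (N • l + l') s < (N • l + l') g := by
    rw [hm, hm]
    linarith [hN s ⟨hs, hsF⟩]
  have hmP : ∀ y ∈ convexHull ℝ S, (N • l + l') y ≤ (N • l + l') g := by
    refine fun y => le_of_mem_convexHull fun s hs => ?_
    by_cases hsF : s ∈ F
    · rw [hm, hm, ((hl s).1 hsF).2]
      linarith [hl'F s hsF]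
    · exact (hmS s hs hsF).le
  have hexp := isExposed_of_support (hF.subset hgF) hmP
  have hsub : {y | y ∈ convexHull ℝ S ∧ (N • l + l') y = (N • l + l') g} ⊆ F := by
    rw [exposed_eq_convexHull_inter hexp]
    refine convexHull_min (fun s hs => ?_) (hF.convex (convex_convexHull ℝ S))
    exact not_imp_comm.1 (hmS s hs.1) hs.2.2.not_lt
  convert hexp
  ext y
  exact ⟨fun hy => ⟨hF.subset (hG.subset hy), (hmF (hG.subset hy)).2 ((hl' y).1 hy).2⟩,
    fun hy => (hl' y).2 ⟨hsub hy, (hmF (hsub hy)).1 hy.2⟩⟩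

lemma exists_strict_support (hS : S.Finite) {v : E} (hv : v ∈ (convexHull ℝ S).extremePoints ℝ) :
    ∃ l : E →L[ℝ] ℝ, ∀ s ∈ S, s ≠ v → l s < l v := by
  rw [(convex_convexHull ℝ S).mem_extremePoints_iff_mem_sdiff_convexHull_sdiff] at hv
  have hv' : v ∉ convexHull ℝ (S \ {v}) := fun h =>
    hv.2 (convexHull_mono (sdiff_subset_sdiff_left (subset_convexHull ℝ S)) h)
  obtain ⟨l, u, hl, hu⟩ := geometric_hahn_banach_closed_point (convex_convexHull ℝ _)
    (hS.sdiff.isCompact_convexHull (𝕜 := ℝ)).isClosed hv'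
  exact ⟨l, fun s hs hsv => (hl s (subset_convexHull ℝ _ ⟨hs, hsv⟩)).trans hu⟩

lemma convexHull_extremePoints_of_finite (hS : S.Finite) :
    convexHull ℝ ((convexHull ℝ S).extremePoints ℝ) = convexHull ℝ S := by
  have hfin := hS.subset (extremePoints_convexHull_subset (𝕜 := ℝ))
  rw [← (hfin.isCompact_convexHull (𝕜 := ℝ)).isClosed.closure_eq]
  exact closure_convexHull_extremePoints (hS.isCompact_convexHull (𝕜 := ℝ)) (convex_convexHull ℝ S)

variable [FiniteDimensional ℝ E] {x : E}

lemma subset_of_mem_intrinsicInterior (hF : IsExposed ℝ P F) (hG : Convex ℝ G) (hGP : G ⊆ P)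
    (hx : x ∈ intrinsicInterior ℝ G) (hxF : x ∈ F) : G ⊆ F := by
  intro y hy
  obtain ⟨l, hlP, hl⟩ := exists_support_of_isExposed hF hxF
  obtain ⟨ε, hε, hmem⟩ := ((mem_intrinsicInterior_iff hG).1 hx).2 y hy
  have hle := hlP _ (hGP hmem)
  rw [map_add, map_smul, map_sub, smul_eq_mul, add_le_iff_nonpos_right,
    mul_nonpos_iff_pos_imp_nonpos] at hle
  exact (hl y).2 ⟨hGP hy, (hlP y (hGP hy)).antisymm (sub_nonpos.1 (hle.1 hε))⟩

lemma exists_face_mem_intrinsicInterior (hS : S.Finite) (hF : IsExposed ℝ (convexHull ℝ S) F)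
    (hx : x ∈ F) : ∃ G ⊆ F, IsExposed ℝ (convexHull ℝ S) G ∧ x ∈ intrinsicInterior ℝ G := by
  induction hn : (S ∩ F).ncard using Nat.strong_induction_on generalizing F with
  | _ n ih =>
    by_cases hxi : x ∈ intrinsicInterior ℝ F
    · exact ⟨F, subset_rfl, hF, hxi⟩
    obtain ⟨l, hl, y, hy, hly⟩ := exists_support_of_notMem_intrinsicInterior
      (hF.convex (convex_convexHull ℝ S)) hx hxi
    have hGF : IsExposed ℝ F (l.toExposed F) := ContinuousLinearMap.toExposed.isExposed
    have hG := isExposed_trans_of_finite hS hF hGF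
    have hlt : (S ∩ l.toExposed F).ncard < n := by
      rw [← hn]
      refine ncard_lt_ncard ((inter_subset_inter_right S hGF.subset).ssubset_of_ne fun h => ?_)
        (hS.inter_of_left F)
      have hFG : F = l.toExposed F := (exposed_eq_convexHull_inter hF).trans
        ((congrArg (convexHull ℝ) h).symm.trans (exposed_eq_convexHull_inter hG).symm)
      exact ((hFG ▸ hy : y ∈ l.toExposed F).2 x hx).not_gt hly
    obtain ⟨G, hGs, hGe, hGx⟩ := ih _ hlt hG ⟨hx, hl⟩ rfl
    exact ⟨G, hGs.trans hGF.subset, hGe, hGx⟩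

lemma exposed_eq_of_mem_intrinsicInterior (hP : Convex ℝ P) (hF : IsExposed ℝ P F)
    (hG : IsExposed ℝ P G) (hxF : x ∈ intrinsicInterior ℝ F) (hxG : x ∈ intrinsicInterior ℝ G) :
    F = G :=
  (subset_of_mem_intrinsicInterior hG (hF.convex hP) hF.subset hxF
    (intrinsicInterior_subset hxG)).antisymm
    (subset_of_mem_intrinsicInterior hF (hG.convex hP) hG.subset hxG
      (intrinsicInterior_subset hxF))

end Exposed

lemma IsLatticePolytope.exists_finset {d : ℕ} {P : Set (Fin d → ℝ)} (hP : IsLatticePolytope P) :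
    ∃ S : Finset (Fin d → ℝ), S.Nonempty ∧ (∀ s ∈ S, s ∈ intLattice d) ∧
      P = convexHull ℝ (S : Set (Fin d → ℝ)) := by
  obtain ⟨T, hT, hne, rfl⟩ := hP.exists_hull
  have hfin := hT.subset (extremePoints_convexHull_subset (𝕜 := ℝ))
  refine ⟨hfin.toFinset, ?_, fun s hs => hP.vertices_integral s (hfin.mem_toFinset.1 hs), ?_⟩
  · rw [Finite.toFinset_nonempty]
    exact (hT.isCompact_convexHull (𝕜 := ℝ)).extremePoints_nonempty hne.convexHull
  · rw [hfin.coe_toFinset, convexHull_extremePoints_of_finite hT]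

end FacesOfPolytopes

section SimplePolytopes

open Set

section SimplicialAt

variable {E ι : Type*} [NormedAddCommGroup E] [NormedSpace ℝ E] {P F : Set E} {v : E} {w : ι → E}

/-- At the vertex `v`, the tangent cone of `P` is the simplicial cone spanned by the linearly
independent vectors `w i`. -/
structure IsSimplicialAt (P : Set E) (v : E) (w : ι → E) : Prop where
  mem : v ∈ P
  linearIndependent : LinearIndependent ℝ w
  sub_mem_hull : ∀ y ∈ P, y - v ∈ PointedCone.hull ℝ (range w)
  exists_add_smul_mem : ∀ i, ∃ δ > (0 : ℝ), v + δ • w i ∈ P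

/-- The face of `P` at `v` spanned by the directions indexed by `J`. -/
def spannedFace (P : Set E) (v : E) (w : ι → E) (J : Finset ι) : Set E :=
  {y | y ∈ P ∧ y - v ∈ Submodule.span ℝ (w '' J)}

lemma mem_spannedFace_iff {J : Finset ι} {y : E} :
    y ∈ spannedFace P v w J ↔ y ∈ P ∧ y - v ∈ Submodule.span ℝ (w '' J) := Iff.rfl

lemma exists_dual_eq_of_linearIndependent [FiniteDimensional ℝ E] (hw : LinearIndependent ℝ w)
    (a : ι → ℝ) : ∃ l : E →L[ℝ] ℝ, ∀ i, l (w i) = a i := by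
  obtain ⟨g, hg⟩ := LinearMap.exists_extend ((Module.Basis.span hw).constr ℝ a)
  refine ⟨g.toContinuousLinearMap, fun i => ?_⟩
  have hi := LinearMap.congr_fun hg (Module.Basis.span hw i)
  rwa [Module.Basis.constr_basis, LinearMap.comp_apply, Submodule.subtype_apply,
    Module.Basis.span_apply] at hi

lemma sum_smul_mem_span_image_iff [Fintype ι] (hw : LinearIndependent ℝ w) {c : ι → ℝ}
    {J : Finset ι} : ∑ i, c i • w i ∈ Submodule.span ℝ (w '' J) ↔ ∀ i ∉ J, c i = 0 := by
  classical
  refine ⟨fun hmem i hi => ?_, fun hc => Submodule.sum_mem _ fun i _ => ?_⟩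
  · obtain ⟨g, hg⟩ := (Fintype.mem_span_image_iff_exists_fun ℝ).1 hmem
    obtain ⟨c', -, hout, hsum⟩ := exists_sum_smul_eq_sum_coe (q := w) g
    have hcc' : ∑ i, (c i - c' i) • w i = 0 := by
      simp only [sub_smul, Finset.sum_sub_distrib, hsum, hg, sub_self]
    rw [sub_eq_zero.1 (Fintype.linearIndependent_iff.1 hw _ hcc' i), hout i (by simpa using hi)]
  · by_cases hi : i ∈ J
    · exact Submodule.smul_mem _ _ (Submodule.subset_span ⟨i, hi, rfl⟩)
    · rw [hc i hi, zero_smul]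
      exact zero_mem _

namespace IsSimplicialAt

lemma self_mem_spannedFace (h : IsSimplicialAt P v w) (J : Finset ι) : v ∈ spannedFace P v w J :=
  ⟨h.mem, by simp⟩

lemma exists_sum_eq_sub [Fintype ι] (h : IsSimplicialAt P v w) (l : E →L[ℝ] ℝ) {y : E}
    (hy : y ∈ P) : ∃ c : ι → ℝ, (∀ i, 0 ≤ c i) ∧ ∑ i, c i • w i = y - v ∧
      ∑ i, c i * l (w i) = l y - l v := by
  obtain ⟨c, hc, hcy⟩ := mem_hull_range_iff.1 (h.sub_mem_hull y hy)
  exact ⟨c, hc, hcy, by rw [← map_sub, ← hcy, map_sum]; simp⟩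

lemma le_of_forall_nonpos [Finite ι] (h : IsSimplicialAt P v w) {l : E →L[ℝ] ℝ}
    (hl : ∀ i, l (w i) ≤ 0) {y : E} (hy : y ∈ P) : l y ≤ l v := by
  have := Fintype.ofFinite ι
  obtain ⟨c, hc, -, hcl⟩ := h.exists_sum_eq_sub l hy
  exact sub_nonpos.1 <| hcl ▸ Finset.sum_nonpos fun i _ =>
    mul_nonpos_of_nonneg_of_nonpos (hc i) (hl i)

lemma spannedFace_eq_of_forall_nonpos [Finite ι] (h : IsSimplicialAt P v w) {l : E →L[ℝ] ℝ}
    (hl : ∀ i, l (w i) ≤ 0) {J : Finset ι} (hJ : ∀ i, i ∈ J ↔ l (w i) = 0) :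
    spannedFace P v w J = {y | y ∈ P ∧ l y = l v} := by
  have := Fintype.ofFinite ι
  refine Set.ext fun y => and_congr_right fun hy => ?_
  obtain ⟨c, hc, hcy, hcl⟩ := h.exists_sum_eq_sub l hy
  rw [← hcy, sum_smul_mem_span_image_iff h.linearIndependent, ← sub_eq_zero (a := l y), ← hcl,
    Finset.sum_eq_zero_iff_of_nonpos fun i _ => mul_nonpos_of_nonneg_of_nonpos (hc i) (hl i)]
  simp only [Finset.mem_univ, forall_const, mul_eq_zero, hJ, or_iff_not_imp_right]

lemma exists_eq_spannedFace [Finite ι] (h : IsSimplicialAt P v w) (hF : IsExposed ℝ P F)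
    (hv : v ∈ F) : ∃ J : Finset ι, F = spannedFace P v w J := by
  obtain ⟨l, hlP, hl⟩ := exists_support_of_isExposed hF hv
  have hw (i : ι) : l (w i) ≤ 0 := by
    obtain ⟨δ, hδ, hmem⟩ := h.exists_add_smul_mem i
    have hle := hlP _ hmem
    rw [map_add, map_smul, smul_eq_mul, add_le_iff_nonpos_right] at hle
    exact nonpos_of_mul_nonpos_right hle hδ
  exact ⟨(toFinite {i | l (w i) = 0}).toFinset, (Set.ext hl).trans
    (h.spannedFace_eq_of_forall_nonpos hw fun i => Finite.mem_toFinset _).symm⟩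

lemma isExposed_spannedFace [Finite ι] [FiniteDimensional ℝ E] (h : IsSimplicialAt P v w)
    (J : Finset ι) : IsExposed ℝ P (spannedFace P v w J) := by
  classical
  obtain ⟨l, hl⟩ := exists_dual_eq_of_linearIndependent h.linearIndependent
    fun i => if i ∈ J then 0 else -1
  have hw (i : ι) : l (w i) ≤ 0 := by
    rw [hl]
    split_ifs <;> norm_num
  rw [h.spannedFace_eq_of_forall_nonpos hw fun i => by simp [hl]]
  exact isExposed_of_support h.mem fun _ => h.le_of_forall_nonpos hw

lemma add_smul_mem_spannedFace_iff (h : IsSimplicialAt P v w) {J : Finset ι} {i : ι} {δ : ℝ}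
    (hδ : 0 < δ) (hmem : v + δ • w i ∈ P) : v + δ • w i ∈ spannedFace P v w J ↔ i ∈ J := by
  rw [mem_spannedFace_iff, add_sub_cancel_left, Submodule.smul_mem_iff _ hδ.ne', and_iff_right hmem]
  exact ⟨fun hi => not_imp_comm.1 h.linearIndependent.notMem_span_image (not_not.2 hi),
    fun hi => Submodule.subset_span ⟨i, hi, rfl⟩⟩

lemma spannedFace_subset_iff (h : IsSimplicialAt P v w) {J K : Finset ι} :
    spannedFace P v w J ⊆ spannedFace P v w K ↔ J ⊆ K := by
  refine ⟨fun hsub i hi => ?_, fun hJK y hy =>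
    ⟨hy.1, Submodule.span_mono (image_mono (Finset.coe_subset.2 hJK)) hy.2⟩⟩
  obtain ⟨δ, hδ, hmem⟩ := h.exists_add_smul_mem i
  exact (h.add_smul_mem_spannedFace_iff hδ hmem).1
    (hsub ((h.add_smul_mem_spannedFace_iff hδ hmem).2 hi))

lemma spannedFace_injective (h : IsSimplicialAt P v w) :
    Function.Injective (spannedFace P v w) := fun _ _ hJK =>
  (h.spannedFace_subset_iff.1 hJK.subset).antisymm (h.spannedFace_subset_iff.1 hJK.superset)

lemma vectorSpan_spannedFace (h : IsSimplicialAt P v w) (J : Finset ι) :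
    vectorSpan ℝ (spannedFace P v w J) = Submodule.span ℝ (w '' J) := by
  rw [vectorSpan_eq_span_vsub_set_right ℝ (h.self_mem_spannedFace J)]
  refine le_antisymm (Submodule.span_le.2 ?_) (Submodule.span_le.2 ?_)
  · rintro _ ⟨y, hy, rfl⟩
    exact hy.2
  · rintro _ ⟨i, hi, rfl⟩
    obtain ⟨δ, hδ, hmem⟩ := h.exists_add_smul_mem i
    refine (Submodule.smul_mem_iff _ hδ.ne').1 (Submodule.subset_span ?_)
    exact ⟨v + δ • w i, (h.add_smul_mem_spannedFace_iff hδ hmem).2 hi, add_sub_cancel_left _ _⟩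

lemma finrank_vectorSpan_spannedFace (h : IsSimplicialAt P v w) (J : Finset ι) :
    Module.finrank ℝ (vectorSpan ℝ (spannedFace P v w J)) = J.card := by
  rw [h.vectorSpan_spannedFace, image_eq_range]
  exact (finrank_span_eq_card (h.linearIndependent.comp _ Subtype.val_injective)).trans
    (Fintype.card_coe J)

lemma ncard_faces [Fintype ι] {d : ℕ} {P : Set (Fin d → ℝ)} {v : Fin d → ℝ} {w : ι → Fin d → ℝ}
    (h : IsSimplicialAt P v w) {p q : ℕ} (hp : p ≤ Fintype.card ι) {G : Set (Fin d → ℝ)}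
    (hG : G ∈ faces P q) (hv : v ∈ G) :
    {F ∈ faces P p | G ⊆ F}.ncard = (Fintype.card ι - q).choose (Fintype.card ι - p) := by
  classical
  obtain ⟨J, rfl⟩ := h.exists_eq_spannedFace hG.2.1 hv
  obtain rfl : J.card = q := (h.finrank_vectorSpan_spannedFace J).symm.trans hG.2.2
  -- Complementation turns the faces `J ⊆ K` into the subsets of `Jᶜ` of size `n - p`.
  have himg : {F ∈ faces P p | spannedFace P v w J ⊆ F} =
      (fun K => spannedFace P v w Kᶜ) '' (Jᶜ.powersetCard (Fintype.card ι - p)) := by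
    ext F
    constructor
    · rintro ⟨⟨-, hF, hdim⟩, hsub⟩
      obtain ⟨K, rfl⟩ := h.exists_eq_spannedFace hF (hsub hv)
      have hK : K.card = p := (h.finrank_vectorSpan_spannedFace K).symm.trans hdim
      refine ⟨Kᶜ, Finset.mem_coe.2 (Finset.mem_powersetCard.2 ⟨?_, ?_⟩), congrArg _ (compl_compl K)⟩
      · exact Finset.compl_subset_compl.2 (h.spannedFace_subset_iff.1 hsub)
      · rw [Finset.card_compl, hK]
    · rintro ⟨K, hK, rfl⟩
      obtain ⟨hKJ, hK⟩ := Finset.mem_powersetCard.1 (Finset.mem_coe.1 hK)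
      refine ⟨⟨⟨v, h.self_mem_spannedFace _⟩, h.isExposed_spannedFace _, ?_⟩,
        h.spannedFace_subset_iff.2 (Finset.subset_compl_comm.1 hKJ)⟩
      rw [polyDim, h.finrank_vectorSpan_spannedFace, Finset.card_compl, hK, Nat.sub_sub_self hp]
  have hinj : Function.Injective fun K => spannedFace P v w Kᶜ :=
    h.spannedFace_injective.comp compl_injective
  rw [himg, ncard_image_of_injective _ hinj, ncard_coe_finset, Finset.card_powersetCard,
    Finset.card_compl]

end IsSimplicialAt

end SimplicialAt

section VertexFigure

variable {E : Type*} [NormedAddCommGroup E] [NormedSpace ℝ E] {S : Set E} {v x : E} {l : E →L[ℝ] ℝ}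

/-- The directions from `v` to the other points of `S`, scaled so that `l` takes the value `-1` on
them when it is maximal on `S` exactly at `v`. Their convex hull is the vertex figure at `v` of the
convex hull of `S`. -/
def vertexFigure (S : Set E) (v : E) (l : E →L[ℝ] ℝ) : Set E :=
  (fun s => (l v - l s)⁻¹ • (s - v)) '' (S \ {v})

lemma exists_add_smul_mem_of_mem_vertexFigure (hl : ∀ s ∈ S, s ≠ v → l s < l v)
    (hx : x ∈ vertexFigure S v l) : ∃ δ > (0 : ℝ), v + δ • x ∈ S := by
  obtain ⟨s, ⟨hs, hsv⟩, rfl⟩ := hx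
  have hpos := sub_pos.2 (hl s hs hsv)
  refine ⟨l v - l s, hpos, ?_⟩
  rwa [smul_inv_smul₀ hpos.ne', add_sub_cancel]

lemma exists_sub_eq_smul_vertexFigure (hl : ∀ s ∈ S, s ≠ v → l s < l v) {s : E} (hs : s ∈ S)
    (hsv : s ≠ v) : ∃ x ∈ vertexFigure S v l, ∃ δ > (0 : ℝ), s - v = δ • x :=
  have hpos := sub_pos.2 (hl s hs hsv)
  ⟨_, ⟨s, ⟨hs, hsv⟩, rfl⟩, _, hpos, (smul_inv_smul₀ hpos.ne' _).symm⟩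

lemma apply_eq_neg_one_of_mem_vertexFigure (hl : ∀ s ∈ S, s ≠ v → l s < l v)
    (hx : x ∈ vertexFigure S v l) : l x = -1 := by
  obtain ⟨s, ⟨hs, hsv⟩, rfl⟩ := hx
  rw [map_smul, map_sub, smul_eq_mul, ← neg_sub (l v), mul_neg,
    inv_mul_cancel₀ (sub_pos.2 (hl s hs hsv)).ne']

lemma finite_vertexFigure (hS : S.Finite) : (vertexFigure S v l).Finite := hS.sdiff.image _

-- If `m` is maximal on the vertex figure exactly at `x`, then `m + m x • l` exposes the edge at `v`
-- in the direction of `x`.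
lemma exists_support_of_mem_extremePoints_vertexFigure (hS : S.Finite)
    (hl : ∀ s ∈ S, s ≠ v → l s < l v)
    (hx : x ∈ (convexHull ℝ (vertexFigure S v l)).extremePoints ℝ) :
    ∃ k : E →L[ℝ] ℝ, k x = 0 ∧
      ∀ s ∈ S, k s < k v ∨ k s = k v ∧ s - v ∈ Submodule.span ℝ {x} := by
  obtain ⟨m, hm⟩ := exists_strict_support (finite_vertexFigure hS) hx
  have hval {y : E} (hy : y ∈ vertexFigure S v l) : (m + m x • l) y = m y - m x := by
    simp only [add_apply, smul_apply, smul_eq_mul, apply_eq_neg_one_of_mem_vertexFigure hl hy,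
      mul_neg_one, sub_eq_add_neg]
  refine ⟨m + m x • l, by rw [hval (extremePoints_convexHull_subset hx), sub_self], fun s hs => ?_⟩
  rcases eq_or_ne s v with rfl | hsv
  · exact Or.inr ⟨rfl, by simp⟩
  obtain ⟨y, hy, δ, hδ, hsy⟩ := exists_sub_eq_smul_vertexFigure hl hs hsv
  have hdiff : (m + m x • l) s - (m + m x • l) v = δ * (m y - m x) := by
    rw [← map_sub, hsy, map_smul, hval hy, smul_eq_mul]
  rcases eq_or_ne y x with rfl | hyx
  · rw [sub_self, mul_zero, sub_eq_zero] at hdiff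
    exact Or.inr ⟨hdiff, hsy ▸ Submodule.smul_mem _ _ (Submodule.mem_span_singleton_self y)⟩
  · exact Or.inl (sub_neg.1 (hdiff ▸ mul_neg_of_pos_of_neg hδ (sub_neg.2 (hm y hy hyx))))

lemma exists_edge_of_mem_extremePoints_vertexFigure (hS : S.Finite) (hvS : v ∈ S)
    (hl : ∀ s ∈ S, s ≠ v → l s < l v)
    (hx : x ∈ (convexHull ℝ (vertexFigure S v l)).extremePoints ℝ) :
    ∃ F, IsExposed ℝ (convexHull ℝ S) F ∧ v ∈ F ∧ vectorSpan ℝ F = Submodule.span ℝ {x} := by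
  obtain ⟨k, hkx, hk⟩ := exists_support_of_mem_extremePoints_vertexFigure hS hl hx
  set F := {y | y ∈ convexHull ℝ S ∧ k y = k v}
  have hvF : v ∈ F := ⟨subset_convexHull ℝ S hvS, rfl⟩
  have hexp : IsExposed ℝ (convexHull ℝ S) F := isExposed_of_support hvF.1 fun y =>
    le_of_mem_convexHull fun s hs => (hk s hs).elim le_of_lt fun h => h.1.le
  refine ⟨F, hexp, hvF, le_antisymm ?_ ?_⟩
  · rw [exposed_eq_convexHull_inter hexp, ← direction_affineSpan, affineSpan_convexHull,
      direction_affineSpan, vectorSpan_eq_span_vsub_set_right ℝ (mem_inter hvS hvF),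
      Submodule.span_le]
    rintro _ ⟨s, hs, rfl⟩
    exact ((hk s hs.1).resolve_left hs.2.2.not_lt).2
  · obtain ⟨δ, hδ, hmem⟩ := exists_add_smul_mem_of_mem_vertexFigure hl
      (extremePoints_convexHull_subset hx)
    have hδF : v + δ • x ∈ F :=
      ⟨subset_convexHull ℝ S hmem, by rw [map_add, map_smul, hkx, smul_zero, add_zero]⟩
    have hδx := vsub_mem_vectorSpan ℝ hδF hvF
    rw [vsub_eq_sub, add_sub_cancel_left] at hδx
    exact (Submodule.span_singleton_le_iff_mem _ _).2 ((Submodule.smul_mem_iff _ hδ.ne').1 hδx)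

lemma sub_mem_hull_extremePoints_vertexFigure (hS : S.Finite)
    (hl : ∀ s ∈ S, s ≠ v → l s < l v) {y : E} (hy : y ∈ convexHull ℝ S) :
    y - v ∈ PointedCone.hull ℝ ((convexHull ℝ (vertexFigure S v l)).extremePoints ℝ) := by
  set C := PointedCone.hull ℝ ((convexHull ℝ (vertexFigure S v l)).extremePoints ℝ)
  have hTC : vertexFigure S v l ⊆ C := by
    refine (subset_convexHull ℝ _).trans ?_
    rw [← convexHull_extremePoints_of_finite (finite_vertexFigure hS)]
    exact convexHull_min Submodule.subset_span C.convex
  refine convexHull_min (t := (· - v) ⁻¹' C) (fun s hs => ?_) ?_ hy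
  · rcases eq_or_ne s v with rfl | hsv
    · simp
    obtain ⟨x, hx, δ, hδ, hsx⟩ := exists_sub_eq_smul_vertexFigure hl hs hsv
    rw [mem_preimage, hsx]
    exact PointedCone.smul_mem C hδ.le (hTC hx)
  · simpa only [sub_eq_add_neg] using C.convex.translate_preimage_left (-v)

lemma injOn_span_singleton_vertexFigure (hl : ∀ s ∈ S, s ≠ v → l s < l v) :
    InjOn (fun x => Submodule.span ℝ {x}) (vertexFigure S v l) := by
  intro x hx y hy hxy
  obtain ⟨c, rfl⟩ := Submodule.mem_span_singleton.1
    (hxy.le (Submodule.mem_span_singleton_self x))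
  have hc := apply_eq_neg_one_of_mem_vertexFigure hl hx
  rw [map_smul, apply_eq_neg_one_of_mem_vertexFigure hl hy, smul_eq_mul] at hc
  rw [show c = 1 by linarith, one_smul]

end VertexFigure

variable {d : ℕ} {S : Set (Fin d → ℝ)} {v : Fin d → ℝ} {l : (Fin d → ℝ) →L[ℝ] ℝ}

lemma encard_extremePoints_vertexFigure_le (hS : S.Finite) (hvS : v ∈ S)
    (hl : ∀ s ∈ S, s ≠ v → l s < l v) :
    ((convexHull ℝ (vertexFigure S v l)).extremePoints ℝ).encard ≤
      {F ∈ faces (convexHull ℝ S) 1 | v ∈ F}.encard := by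
  choose! e he hve hspan using fun x =>
    exists_edge_of_mem_extremePoints_vertexFigure (x := x) hS hvS hl
  refine encard_le_encard_of_injOn (f := e) (fun x hx => ⟨⟨⟨v, hve x hx⟩, he x hx, ?_⟩, hve x hx⟩)
    fun x hx y hy hxy => injOn_span_singleton_vertexFigure hl (extremePoints_convexHull_subset hx)
      (extremePoints_convexHull_subset hy) ?_
  · rw [polyDim, hspan x hx]
    refine finrank_span_singleton fun hx0 => ?_
    have := apply_eq_neg_one_of_mem_vertexFigure hl (extremePoints_convexHull_subset hx)
    norm_num [hx0] at this
  · exact (hspan x hx).symm.trans ((congrArg _ hxy).trans (hspan y hy))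

lemma polyDim_le_finrank_span {X : Set (Fin d → ℝ)} {P : Set (Fin d → ℝ)} (hv : v ∈ P)
    (hX : ∀ y ∈ P, y - v ∈ PointedCone.hull ℝ X) :
    polyDim P ≤ Module.finrank ℝ (Submodule.span ℝ X) := by
  refine Submodule.finrank_mono ?_
  rw [vectorSpan_eq_span_vsub_set_right ℝ hv, Submodule.span_le]
  rintro _ ⟨y, hy, rfl⟩
  exact PointedCone.hull_le_span ℝ X (hX y hy)

-- The vertex figure at `v` has at most as many vertices as there are edges through `v`, namely
-- `dim P`, while the directions to these vertices span a space of dimension at least `dim P`.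
lemma IsSimplePolytope.exists_isSimplicialAt (hs : IsSimplePolytope (convexHull ℝ S))
    (hS : S.Finite) (hv : v ∈ (convexHull ℝ S).extremePoints ℝ) :
    ∃ X : Finset (Fin d → ℝ), X.card = polyDim (convexHull ℝ S) ∧
      IsSimplicialAt (convexHull ℝ S) v (fun x : X => (x : Fin d → ℝ)) := by
  obtain ⟨l, hl⟩ := exists_strict_support hS hv
  have hfin := (finite_vertexFigure (v := v) (l := l) hS).subset
    (extremePoints_convexHull_subset (𝕜 := ℝ))
  have hcard := encard_extremePoints_vertexFigure_le hS (extremePoints_convexHull_subset hv) hl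
  rw [hs v hv, hfin.encard_eq_coe_toFinset_card, Nat.cast_le] at hcard
  have hrange : range (fun x : hfin.toFinset => (x : Fin d → ℝ)) =
      (convexHull ℝ (vertexFigure S v l)).extremePoints ℝ := by simp
  have hsub (y) (hy : y ∈ convexHull ℝ S) := sub_mem_hull_extremePoints_vertexFigure hS hl hy
  rw [← hrange] at hsub
  have hdim := polyDim_le_finrank_span (extremePoints_subset hv) hsub
  have hle := finrank_range_le_card (R := ℝ) fun x : hfin.toFinset => (x : Fin d → ℝ)
  rw [Set.finrank, Fintype.card_coe] at hle
  refine ⟨hfin.toFinset, hcard.antisymm (hdim.trans hle), extremePoints_subset hv, ?_, hsub,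
    fun x => ?_⟩
  · rw [linearIndependent_iff_card_le_finrank_span, Fintype.card_coe]
    exact hcard.trans hdim
  · obtain ⟨δ, hδ, hmem⟩ := exists_add_smul_mem_of_mem_vertexFigure hl
      (extremePoints_convexHull_subset (hfin.mem_toFinset.1 x.2))
    exact ⟨δ, hδ, subset_convexHull ℝ S hmem⟩

lemma IsSimplePolytope.ncard_faces (hs : IsSimplePolytope (convexHull ℝ S)) (hS : S.Finite)
    {p q : ℕ} (hp : p ≤ polyDim (convexHull ℝ S)) {G : Set (Fin d → ℝ)}
    (hG : G ∈ faces (convexHull ℝ S) q) :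
    {F ∈ faces (convexHull ℝ S) p | G ⊆ F}.ncard =
      (polyDim (convexHull ℝ S) - q).choose (polyDim (convexHull ℝ S) - p) := by
  obtain ⟨v, hv⟩ := (hG.2.1.isCompact (hS.isCompact_convexHull (𝕜 := ℝ))).extremePoints_nonempty
    hG.1
  obtain ⟨X, hX, hsimp⟩ := hs.exists_isSimplicialAt hS
    (hG.2.1.isExtreme.extremePoints_subset_extremePoints hv)
  rw [← hX, ← Fintype.card_coe X] at hp ⊢
  exact hsimp.ncard_faces hp hG (extremePoints_subset hv)

end SimplePolytopes

section DifferenceCalculus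

open Polynomial Finset
open scoped Nat

lemma neg_one_pow_eq_pow_of_add_eq_two_mul {R : Type*} [Ring R] {a b c : ℕ} (h : a + b = 2 * c) :
    (-1 : R) ^ a = (-1) ^ b :=
  neg_one_pow_congr (by grind)

section Interpolation

variable {R : Type*} [CommRing R]

lemma fwdDiff_iter_eval {f : R[X]} {k : ℕ} (hf : f.natDegree ≤ k) (y : R) :
    (fwdDiff 1)^[k] f.eval y = k ! * f.coeff k := by
  rcases hf.lt_or_eq with hlt | rfl
  · rw [fwdDiff_iter_eq_zero_of_degree_lt hlt, coeff_eq_zero_of_natDegree_lt hlt, mul_zero,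
      Pi.zero_apply]
  · simp [fwdDiff_iter_degree_eq_factorial, mul_comm]

lemma sum_neg_one_pow_mul_choose_mul_eval {f : R[X]} {k M : ℕ} (hf : f.natDegree ≤ k) (hM : k < M)
    (y : R) :
    ∑ j ∈ range M, (-1) ^ (k + j) * (k.choose j : R) * f.eval (y + j) = k ! * f.coeff k := by
  have hbinom : ∀ j ∈ range M, j ∉ range (k + 1) →
      (-1) ^ (k + j) * (k.choose j : R) * f.eval (y + j) = 0 := fun j _ hj => by
    rw [Nat.choose_eq_zero_of_lt (by simpa using hj)]
    simp
  rw [← sum_subset (range_subset_range.2 hM) hbinom, ← fwdDiff_iter_eval hf y,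
    fwdDiff_iter_eq_sum_shift]
  refine sum_congr rfl fun j hj => ?_
  have hsign : (-1 : R) ^ (k + j) = (-1) ^ (k - j) :=
    neg_one_pow_eq_pow_of_add_eq_two_mul (c := k) (by have := mem_range.1 hj; omega)
  rw [hsign]
  simp

lemma factorial_mul_coeff_eq_sum_add_sum {g : R[X]} {p m N : ℕ} (hg : g.natDegree ≤ p)
    (hN : p < m + N) :
    ((p + 1)! : R) * g.coeff p =
      ∑ i ∈ range N, (-1) ^ (p + 1 + m + (i + 1)) * ((p + 1).choose (m + (i + 1)) : R) *
        (((i + 1 : ℕ) : R) * g.eval ((i + 1 : ℕ) : R)) +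
      ∑ i ∈ range m, (-1) ^ (p + m + (i + 1)) * ((p + 1).choose (m - (i + 1)) : R) *
        (((i + 1 : ℕ) : R) * g.eval (-((i + 1 : ℕ) : R))) := by
  have hXg : (X * g).natDegree ≤ p + 1 := natDegree_mul_le.trans <| by
    have := natDegree_X_le (R := R)
    omega
  rw [← coeff_X_mul, ← sum_neg_one_pow_mul_choose_mul_eval hXg
    (show p + 1 < m + (N + 1) by omega) (-(m : R)), sum_range_add, sum_range_succ', add_comm,
    ← sum_range_reflect _ m]
  congr 1
  · have hzero : (-(m : R)) + ((m + 0 : ℕ) : R) = 0 := by simp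
    rw [hzero, eval_mul, eval_X, zero_mul, mul_zero, add_zero]
    refine sum_congr rfl fun i _ => ?_
    have hpoint : (-(m : R)) + ((m + (i + 1) : ℕ) : R) = ((i + 1 : ℕ) : R) := by push_cast; ring
    rw [hpoint, eval_mul, eval_X, add_assoc (p + 1)]
  · refine sum_congr rfl fun i hi => ?_
    have him : i + 1 ≤ m := mem_range.1 hi
    have hpoint : (-(m : R)) + ((m - (i + 1) : ℕ) : R) = -((i + 1 : ℕ) : R) := by
      rw [Nat.cast_sub him]
      ring
    have hsign : (-1 : R) ^ (p + 1 + (m - (i + 1))) = (-1) ^ (p + m + (i + 1) + 1) :=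
      neg_one_pow_eq_pow_of_add_eq_two_mul (c := p + m + 1) (by omega)
    rw [Nat.sub_sub, Nat.add_comm 1 i, hpoint, hsign, eval_mul, eval_X, pow_succ]
    ring

end Interpolation

lemma fwdDiff_iter_choose_apply {a N r : ℕ} (hr : r ≤ a + N) :
    (fwdDiff 1)^[N] (fun x ↦ x.choose r : ℕ → ℤ) a = a.choose (a + N - r) := by
  rcases le_or_gt N r with hle | hlt
  · obtain ⟨s, rfl⟩ := Nat.exists_eq_add_of_le hle
    simp only [fwdDiff_iter_choose]
    rw [show a + N - (N + s) = a - s by omega, Nat.choose_symm (by omega)]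
  · obtain ⟨k, rfl⟩ := Nat.exists_eq_add_of_lt hlt
    have hconst : (fwdDiff 1)^[r] (fun x ↦ x.choose r : ℕ → ℤ) = fun _ => 1 := by
      simpa using fwdDiff_iter_choose 0 r
    have hzero : (fwdDiff 1)^[k] (fun _ => 0 : ℕ → ℤ) = 0 :=
      Function.iterate_fixed (fwdDiff_const (h := 1) (0 : ℤ)) k
    rw [show r + k + 1 = (k + 1) + r by ring, Function.iterate_add_apply, hconst,
      Function.iterate_succ_apply, fwdDiff_const, Nat.choose_eq_zero_of_lt (by omega)]
    exact congr_fun hzero a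

section DehnSommerville

variable {R : Type*} [CommRing R]

lemma sum_neg_one_pow_mul_choose_mul_choose {n q r : ℕ} (hq : q ≤ n) (hr : r ≤ n + 1) :
    ∑ p ∈ range (n + 1), (-1) ^ p * ((n - q).choose (n - p) : R) * ((p + 1).choose r : R) =
      (-1) ^ n * ((q + 1).choose (n + 1 - r) : R) := by
  obtain ⟨N, rfl⟩ := Nat.exists_eq_add_of_le hq
  have hlow : ∀ p ∈ range q, (-1) ^ p * ((q + N - q).choose (q + N - p) : R) *
      ((p + 1).choose r : R) = 0 := fun p hp => by
    have := mem_range.1 hp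
    rw [Nat.choose_eq_zero_of_lt (by omega)]
    simp
  have hdiff := fwdDiff_iter_choose_apply (a := q + 1) (N := N) (r := r) (by omega)
  rw [fwdDiff_iter_eq_sum_shift] at hdiff
  rw [add_assoc q N 1, sum_range_add, sum_eq_zero hlow, zero_add, ← add_assoc,
    show q + N + 1 = q + 1 + N by ring, ← Int.cast_natCast ((q + 1).choose _), ← hdiff,
    Int.cast_sum, mul_sum]
  refine sum_congr rfl fun k hk => ?_
  have hkN : k ≤ N := Nat.lt_succ_iff.1 (mem_range.1 hk)
  have hsign : (-1 : R) ^ (q + k) = (-1) ^ (q + N + (N - k)) :=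
    neg_one_pow_eq_pow_of_add_eq_two_mul (c := q + N) (by omega)
  rw [hsign, Nat.add_sub_cancel_left, Nat.add_sub_add_left, Nat.choose_symm hkN, pow_add]
  simp [add_right_comm, mul_assoc]

lemma sum_choose_mul_eq_of_dehnSommerville {n r : ℕ} {a b : ℕ → R}
    (h : ∀ p ≤ n, (-1) ^ p * a p = ∑ q ∈ range (n + 1), ((n - q).choose (n - p) : R) * b q)
    (hr : r ≤ n + 1) :
    ∑ p ∈ range (n + 1), ((p + 1).choose r : R) * a p =
      (-1) ^ n * ∑ q ∈ range (n + 1), ((q + 1).choose (n + 1 - r) : R) * b q := by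
  have ha : ∀ p ≤ n, a p =
      ∑ q ∈ range (n + 1), (-1) ^ p * (((n - q).choose (n - p) : R) * b q) := fun p hp => by
    rw [← mul_sum, ← h p hp, ← mul_assoc, ← mul_pow]
    simp
  calc ∑ p ∈ range (n + 1), ((p + 1).choose r : R) * a p
      = ∑ p ∈ range (n + 1), ∑ q ∈ range (n + 1),
          (-1) ^ p * ((n - q).choose (n - p) : R) * ((p + 1).choose r : R) * b q := by
        refine sum_congr rfl fun p hp => ?_
        rw [ha p (Nat.lt_succ_iff.1 (mem_range.1 hp)), mul_sum]
        exact sum_congr rfl fun q _ => by ring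
    _ = (-1) ^ n * ∑ q ∈ range (n + 1), ((q + 1).choose (n + 1 - r) : R) * b q := by
        rw [sum_comm, mul_sum]
        refine sum_congr rfl fun q hq => ?_
        rw [← sum_mul, sum_neg_one_pow_mul_choose_mul_choose
          (Nat.lt_succ_iff.1 (mem_range.1 hq)) hr, mul_assoc]

lemma sum_sum_eval_neg_eq {n m : ℕ} (hm : m ≤ n + 1) {g : ℕ → R[X]} {I : ℕ → ℕ → R}
    (hrec : ∀ p ≤ n, ∀ k : ℕ, 1 ≤ k → (-1) ^ p * (g p).eval (-(k : R)) =
      ∑ q ∈ range (n + 1), ((n - q).choose (n - p) : R) * I q k) :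
    ∑ p ∈ range (n + 1), ∑ i ∈ range m, (-1) ^ (n + m + (i + 1)) *
        ((p + 1).choose (m - (i + 1)) : R) *
        (((i + 1 : ℕ) : R) * (g p).eval (-((i + 1 : ℕ) : R))) =
      ∑ p ∈ range (n + 1), ∑ i ∈ range (n + 1), (-1) ^ (m + (i + 1)) *
        ((p + 1).choose (n + 1 - m + (i + 1)) : R) * (((i + 1 : ℕ) : R) * I p (i + 1)) := by
  have hbinom : ∀ i ∈ range (n + 1), i ∉ range m → ∑ p ∈ range (n + 1), (-1) ^ (m + (i + 1)) *
      ((p + 1).choose (n + 1 - m + (i + 1)) : R) * (((i + 1 : ℕ) : R) * I p (i + 1)) = 0 := by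
    refine fun i _ hi => sum_eq_zero fun p hp => ?_
    rw [mem_range] at hi hp
    rw [Nat.choose_eq_zero_of_lt (by omega)]
    simp
  rw [sum_comm, sum_comm (s := range (n + 1)) (t := range (n + 1)),
    ← sum_subset (range_subset_range.2 hm) hbinom]
  refine sum_congr rfl fun i hi => ?_
  have him : i + 1 ≤ m := mem_range.1 hi
  have hsum := sum_choose_mul_eq_of_dehnSommerville (fun p hp => hrec p hp (i + 1) (by omega))
    (show m - (i + 1) ≤ n + 1 by omega)
  have hsign : (-1 : R) ^ (m + (i + 1)) = (-1) ^ (n + m + (i + 1)) * (-1) ^ n := by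
    rw [← pow_add]
    exact neg_one_pow_eq_pow_of_add_eq_two_mul (c := n + m + (i + 1)) (by ring)
  calc _ = (-1) ^ (n + m + (i + 1)) * ((i + 1 : ℕ) : R) * ∑ p ∈ range (n + 1),
        ((p + 1).choose (m - (i + 1)) : R) * (g p).eval (-((i + 1 : ℕ) : R)) := by
        rw [mul_sum]
        exact sum_congr rfl fun p _ => by ring
    _ = _ := by
        rw [hsum, hsign, mul_sum, mul_sum,
          show n + 1 - (m - (i + 1)) = n + 1 - m + (i + 1) by omega]
        exact sum_congr rfl fun p _ => by ring

theorem sum_coeff_eq_of_dehnSommerville {n m : ℕ} (hm : m ≤ n + 1) {g : ℕ → R[X]}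
    (hdeg : ∀ p ≤ n, (g p).natDegree ≤ p) {I : ℕ → ℕ → R}
    (hI : ∀ p ≤ n, ∀ k : ℕ, 1 ≤ k → (g p).eval (k : R) = I p k)
    (hrec : ∀ p ≤ n, ∀ k : ℕ, 1 ≤ k → (-1) ^ p * (g p).eval (-(k : R)) =
      ∑ q ∈ range (n + 1), ((n - q).choose (n - p) : R) * I q k) :
    ∑ p ∈ range (n + 1), (-1) ^ (n - p) * (((p + 1)! : R) * (g p).coeff p) =
      ∑ p ∈ range (n + 1), ∑ i ∈ range (n + 1),
        ((-1) ^ (n + 1 + m + (i + 1)) * ((p + 1).choose (m + (i + 1)) : R) +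
          (-1) ^ (m + (i + 1)) * ((p + 1).choose (n + 1 - m + (i + 1)) : R)) *
          (((i + 1 : ℕ) : R) * I p (i + 1)) := by
  have hsplit : ∀ p ∈ range (n + 1), (-1) ^ (n - p) * (((p + 1)! : R) * (g p).coeff p) =
      ∑ i ∈ range (n + 1), (-1) ^ (n + 1 + m + (i + 1)) * ((p + 1).choose (m + (i + 1)) : R) *
        (((i + 1 : ℕ) : R) * I p (i + 1)) +
      ∑ i ∈ range m, (-1) ^ (n + m + (i + 1)) * ((p + 1).choose (m - (i + 1)) : R) *
        (((i + 1 : ℕ) : R) * (g p).eval (-((i + 1 : ℕ) : R))) := fun p hp => by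
    have hpn : p ≤ n := Nat.lt_succ_iff.1 (mem_range.1 hp)
    rw [factorial_mul_coeff_eq_sum_add_sum (hdeg p hpn) (show p < m + (n + 1) by omega), mul_add,
      mul_sum, mul_sum]
    refine congr_arg₂ _ (sum_congr rfl fun i _ => ?_) (sum_congr rfl fun i _ => ?_)
    · rw [hI p hpn _ (by omega), ← mul_assoc, ← mul_assoc ((-1) ^ _), ← pow_add,
        show n - p + (p + 1 + m + (i + 1)) = n + 1 + m + (i + 1) by omega]
    · rw [← mul_assoc, ← mul_assoc ((-1) ^ _), ← pow_add,
        show n - p + (p + m + (i + 1)) = n + m + (i + 1) by omega]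
  rw [sum_congr rfl hsplit, sum_add_distrib, sum_sum_eval_neg_eq hm hrec, ← sum_add_distrib]
  refine sum_congr rfl fun p _ => ?_
  rw [← sum_add_distrib]
  exact sum_congr rfl fun i _ => (add_mul _ _ _).symm

end DehnSommerville

end DifferenceCalculus

section LatticeVolume

open Bornology Filter MeasureTheory Module Polynomial Set Topology

lemma tendsto_eval_natCast_div_pow {f : ℝ[X]} {p : ℕ} (hf : f.natDegree ≤ p) :
    Tendsto (fun n : ℕ => f.eval (n : ℝ) / (n : ℝ) ^ p) atTop (𝓝 (f.coeff p)) := by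
  suffices h : Tendsto (fun x : ℝ => f.eval x / (X ^ p : ℝ[X]).eval x) atTop (𝓝 (f.coeff p)) by
    simpa [Function.comp_def] using h.comp tendsto_natCast_atTop_atTop
  by_cases hd : f.degree = p
  · have hlead := f.div_tendsto_atTop_leadingCoeff_div_of_degree_eq (X ^ p)
      (by rw [hd, degree_X_pow])
    rwa [leadingCoeff_X_pow, div_one, leadingCoeff, natDegree_eq_of_degree_eq_some hd] at hlead
  · have hlt : f.degree < p := lt_of_le_of_ne (natDegree_le_iff_degree_le.1 hf) hd
    rw [coeff_eq_zero_of_degree_lt hlt]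
    exact f.div_tendsto_atTop_zero_of_degree_lt (X ^ p) (by rwa [degree_X_pow])

section Covolume

variable {W ι : Type*} [NormedAddCommGroup W] [NormedSpace ℝ W] [MeasurableSpace W] [BorelSpace W]

lemma volume_image_equivFun [Fintype ι] (b : Basis ι ℝ W) (s : Set W) :
    volume (b.equivFun '' s) = b.addHaar s := by
  have : FiniteDimensional ℝ W := b.finiteDimensional_of_finite
  have hmap : (volume : Measure (ι → ℝ)) = b.addHaar.map b.equivFunL := by
    have hb : b.map b.equivFunL.toLinearEquiv = Pi.basisFun ℝ ι := by
      classical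
      refine Basis.eq_of_apply_eq fun i => funext fun j => ?_
      simp [Finsupp.single_apply, Pi.single_apply, eq_comm]
    rw [b.map_addHaar b.equivFunL, hb, Basis.addHaar_def, Basis.parallelepiped_basisFun,
      addHaarMeasure_eq_volume_pi]
  rw [hmap]
  exact (b.equivFunL.toHomeomorph.toMeasurableEquiv.map_apply _).trans
    (congr_arg _ (preimage_image_eq s b.equivFun.injective))

variable [FiniteDimensional ℝ W] (L : Submodule ℤ W) [DiscreteTopology L] [IsZLattice ℝ L]
  (μ : Measure W) [μ.IsAddHaarMeasure]

lemma volume_real_image_eq_div_covolume [Fintype ι] (b : Basis ι ℤ L) (s : Set W) :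
    volume.real ((b.ofZLatticeBasis ℝ L).equivFun '' s) = μ.real s / ZLattice.covolume L μ := by
  set e := b.ofZLatticeBasis ℝ L
  have hcov : ZLattice.covolume L μ = μ.real (parallelepiped e) := by
    rw [ZLattice.covolume_eq_measure_fundamentalDomain L μ (ZLattice.isAddFundamentalDomain b μ)]
    exact measureReal_congr (ZSpan.fundamentalDomain_ae_parallelepiped e μ)
  have hμ : μ = μ (parallelepiped e) • e.addHaar := by
    simpa [Basis.addHaar_def] using (Measure.addHaarMeasure_unique μ e.parallelepiped)
  have hscale : μ.real s = ZLattice.covolume L μ * e.addHaar.real s := by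
    rw [hcov]
    nth_rw 1 [hμ]
    rw [measureReal_ennreal_smul_apply]
    rfl
  rw [hscale, mul_div_cancel_left₀ _ (ZLattice.covolume_ne_zero L μ), Measure.real, Measure.real,
    volume_image_equivFun]

lemma coeff_finrank_eq_div_covolume {s : Set W} (hbdd : IsBounded s) (hmeas : MeasurableSet s)
    (hconv : Convex ℝ s) {f : ℝ[X]} (hf : f.natDegree ≤ finrank ℝ W)
    (hcount : ∀ n : ℕ, 1 ≤ n → f.eval (n : ℝ) = (s ∩ (n : ℝ)⁻¹ • (L : Set W)).ncard) :
    f.coeff (finrank ℝ W) = μ.real s / ZLattice.covolume L μ := by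
  let b := Free.chooseBasis ℤ L
  have hfront : volume (frontier ((b.ofZLatticeBasis ℝ L).equivFun '' s)) = 0 :=
    (hconv.linear_image (b.ofZLatticeBasis ℝ L).equivFun.toLinearMap).addHaar_frontier volume
  have hlim := ZLattice.covolume.tendsto_card_div_pow'' b hbdd hmeas hfront
  rw [volume_real_image_eq_div_covolume L μ b s,
    ← finrank_eq_card_basis (b.ofZLatticeBasis ℝ L)] at hlim
  refine tendsto_nhds_unique (tendsto_eval_natCast_div_pow hf) (hlim.congr' ?_)
  filter_upwards [eventually_ge_atTop 1] with n hn
  rw [hcount n hn, Nat.card_coe_set_eq]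

end Covolume

section DirectionLattice

variable {d : ℕ} {F : Set (Fin d → ℝ)} {v : Fin d → ℝ}

lemma intLattice_eq_span (d : ℕ) :
    intLattice d = Submodule.span ℤ (range (Pi.basisFun ℝ (Fin d))) := by
  ext x
  rw [Basis.mem_span_iff_repr_mem]
  exact Iff.rfl

instance (d : ℕ) : DiscreteTopology (intLattice d) := by
  rw [intLattice_eq_span]
  infer_instance

instance (F : Set (Fin d → ℝ)) : DiscreteTopology (directionLattice F) :=
  ZLattice.comap_discreteTopology ℝ (intLattice d) (e := (vectorSpan ℝ F).subtype)
    continuous_subtype_val Subtype.val_injective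

lemma vectorSpan_convexHull (S : Set (Fin d → ℝ)) :
    vectorSpan ℝ (convexHull ℝ S) = vectorSpan ℝ S := by
  rw [← direction_affineSpan, affineSpan_convexHull, direction_affineSpan]

lemma isZLattice_directionLattice_convexHull {S : Set (Fin d → ℝ)}
    (hS : ∀ s ∈ S, s ∈ intLattice d) : IsZLattice ℝ (directionLattice (convexHull ℝ S)) where
  span_top := by
    set F := convexHull ℝ S
    have hle : vectorSpan ℝ F ≤ (Submodule.span ℝ
        (directionLattice F : Set (vectorSpan ℝ F))).map (vectorSpan ℝ F).subtype := by
      refine (vectorSpan_convexHull S).le.trans (Submodule.span_le.2 ?_)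
      rintro _ ⟨s, hs, t, ht, rfl⟩
      exact ⟨⟨s - t, vsub_mem_vectorSpan ℝ (subset_convexHull ℝ S hs) (subset_convexHull ℝ S ht)⟩,
        Submodule.subset_span (sub_mem (hS s hs) (hS t ht)), rfl⟩
    refine eq_top_iff.2 fun w _ => ?_
    obtain ⟨w', hw', heq⟩ := hle w.2
    rwa [← Subtype.ext heq]

lemma latticeVolume_eq_of_mem (hv : v ∈ F) :
    latticeVolume F = ((polyDim F).factorial : ℝ) *
      ((Measure.addHaar : Measure (vectorSpan ℝ F)).real {w | v + (w : Fin d → ℝ) ∈ F} /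
        ZLattice.covolume (directionLattice F) Measure.addHaar) := by
  have hne : F.Nonempty := ⟨v, hv⟩
  let a : vectorSpan ℝ F := ⟨hne.some - v, vsub_mem_vectorSpan ℝ hne.some_mem hv⟩
  have htranslate : {w : vectorSpan ℝ F | hne.some + (w : Fin d → ℝ) ∈ F} =
      (· + a) ⁻¹' {w | v + (w : Fin d → ℝ) ∈ F} := by
    ext w
    have hw : hne.some + (w : Fin d → ℝ) = v + ((w : Fin d → ℝ) + (hne.some - v)) := by abel
    simp [a, hw]
  rw [latticeVolume, dif_pos hne, htranslate, Measure.real, measure_preimage_add_right,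
    ← Measure.real]

lemma ncard_inter_inv_smul_directionLattice (hv : v ∈ F) (hvL : v ∈ intLattice d) {n : ℕ}
    (hn : 1 ≤ n) :
    ({w : vectorSpan ℝ F | v + (w : Fin d → ℝ) ∈ F} ∩
        (n : ℝ)⁻¹ • (directionLattice F : Set (vectorSpan ℝ F))).ncard =
      {x | x ∈ intLattice d ∧ x ∈ (n : ℝ) • F}.ncard := by
  have hn0 : (n : ℝ) ≠ 0 := by positivity
  have hnv : (n : ℝ) • v ∈ intLattice d := by
    rw [Nat.cast_smul_eq_nsmul]
    exact nsmul_mem hvL n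
  have hmem : ∀ w : vectorSpan ℝ F, w ∈ (n : ℝ)⁻¹ • (directionLattice F : Set (vectorSpan ℝ F)) ↔
      (n : ℝ) • (v + (w : Fin d → ℝ)) ∈ intLattice d := fun w => by
    rw [mem_smul_set_iff_inv_smul_mem₀ (inv_ne_zero hn0), inv_inv, smul_add,
      Submodule.add_mem_iff_right _ hnv]
    exact Iff.rfl
  have hinj : Function.Injective fun w : vectorSpan ℝ F => (n : ℝ) • (v + (w : Fin d → ℝ)) :=
    (smul_right_injective _ hn0).comp ((add_right_injective v).comp Subtype.val_injective)
  rw [← ncard_image_of_injective _ hinj]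
  congr 1
  ext x
  constructor
  · rintro ⟨w, ⟨hwF, hwL⟩, rfl⟩
    exact ⟨(hmem w).1 hwL, smul_mem_smul_set hwF⟩
  · rintro ⟨hxL, u, hu, rfl⟩
    let w : vectorSpan ℝ F := ⟨u - v, vsub_mem_vectorSpan ℝ hu hv⟩
    have hw : v + (w : Fin d → ℝ) = u := add_sub_cancel v u
    refine ⟨w, ⟨?_, (hmem w).2 ?_⟩, congr_arg ((n : ℝ) • ·) hw⟩
    · rwa [mem_ofPred_eq, hw]
    · rwa [hw]

theorem latticeVolume_convexHull_eq_factorial_mul_coeff {p : ℕ} {S : Finset (Fin d → ℝ)}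
    (hne : S.Nonempty) (hS : ∀ s ∈ S, s ∈ intLattice d)
    (hp : polyDim (convexHull ℝ (S : Set (Fin d → ℝ))) = p) {f : ℝ[X]} (hf : f.natDegree ≤ p)
    (hft : ∀ t : ℕ, 1 ≤ t → f.eval (t : ℝ) =
      {x | x ∈ intLattice d ∧ x ∈ (t : ℝ) • convexHull ℝ (S : Set (Fin d → ℝ))}.ncard) :
    latticeVolume (convexHull ℝ (S : Set (Fin d → ℝ))) = (p.factorial : ℝ) * f.coeff p := by
  have := isZLattice_directionLattice_convexHull hS
  set F := convexHull ℝ (S : Set (Fin d → ℝ))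
  obtain ⟨v, hvS⟩ := hne
  have hv : v ∈ F := subset_convexHull ℝ _ hvS
  have hcomp : IsCompact F := S.finite_toSet.isCompact_convexHull (𝕜 := ℝ)
  have hembed : Topology.IsClosedEmbedding fun w : vectorSpan ℝ F => v + (w : Fin d → ℝ) :=
    (Homeomorph.addLeft v).isClosedEmbedding.comp
      (vectorSpan ℝ F).closed_of_finiteDimensional.isClosedEmbedding_subtypeVal
  have hsection : IsCompact {w : vectorSpan ℝ F | v + (w : Fin d → ℝ) ∈ F} :=
    hembed.isCompact_preimage hcomp
  have hconv : Convex ℝ {w : vectorSpan ℝ F | v + (w : Fin d → ℝ) ∈ F} :=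
    ((convex_convexHull ℝ _).translate_preimage_right v).linear_preimage (vectorSpan ℝ F).subtype
  subst hp
  rw [latticeVolume_eq_of_mem hv, polyDim, coeff_finrank_eq_div_covolume (directionLattice F)
    Measure.addHaar hsection.isBounded hsection.measurableSet hconv hf fun n hn => ?_]
  rw [hft n hn, ncard_inter_inv_smul_directionLattice hv (hS v hvS) hn]

end DirectionLattice

end LatticeVolume

section DiscriminantFormula

open Finset Polynomial
open scoped Nat

lemma IsEhrhartPair.exists_symm {p : ℕ} {f : ℝ[X]} {N N' : ℕ → ℕ} (h : IsEhrhartPair p f N N') :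
    ∃ g, IsEhrhartPair p g N' N ∧ g.coeff p = f.coeff p := by
  have hsq : (-1 : ℝ) ^ p * (-1) ^ p = 1 := by rw [← mul_pow]; simp
  refine ⟨C ((-1) ^ p) * f.comp (C (-1) * X), ⟨?_, fun t ht => ?_, fun t ht => ?_⟩, ?_⟩
  · refine (natDegree_C_mul_le _ _).trans ?_
    rw [natDegree_comp, natDegree_C_mul_X _ (by norm_num), mul_one]
    exact h.natDegree_le
  · simpa using h.eval_neg t ht
  · rw [eval_mul, eval_C, ← mul_assoc, hsq]
    simpa using h.eval_natCast t ht
  · rw [coeff_C_mul, comp_C_mul_X_coeff, mul_left_comm, hsq, mul_one]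

variable {d p q t : ℕ} {F P : Set (Fin d → ℝ)}

/-- The number of lattice points in the `t`-th dilate of `F`. -/
noncomputable def latticeCount (F : Set (Fin d → ℝ)) (t : ℕ) : ℕ :=
  {x | x ∈ intLattice d ∧ x ∈ (t : ℝ) • F}.ncard

/-- The number of lattice points in the relative interior of the `t`-th dilate of `F`, so that
`interiorPoints P p t` is the sum of these numbers over the `p`-dimensional faces of `P`. -/
noncomputable def interiorLatticeCount (F : Set (Fin d → ℝ)) (t : ℕ) : ℕ :=
  {x | x ∈ intLattice d ∧ x ∈ intrinsicInterior ℝ ((t : ℝ) • F)}.ncard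

lemma IsLatticePolytope.exists_isEhrhartPair_face (hP : IsLatticePolytope P) (hF : F ∈ faces P p) :
    ∃ g : ℝ[X], IsEhrhartPair p g (interiorLatticeCount F) (latticeCount F) ∧
      latticeVolume F = p ! * g.coeff p := by
  classical
  obtain ⟨S, -, hS, rfl⟩ := hP.exists_finset
  obtain ⟨hne, hexp, hdim⟩ := hF
  let T := S.filter (· ∈ F)
  have hFT : F = convexHull ℝ (T : Set (Fin d → ℝ)) := by
    rw [coe_filter]
    exact exposed_eq_convexHull_inter hexp
  have hTne : T.Nonempty := by
    rw [hFT, convexHull_nonempty_iff] at hne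
    exact_mod_cast hne
  have hT : ∀ s ∈ T, s ∈ intLattice d := fun s hs => hS s (mem_filter.1 hs).1
  rw [hFT] at hdim ⊢
  obtain ⟨f, hf⟩ := exists_isEhrhartPair_convexHull hTne hT hdim
  obtain ⟨g, hg, hgf⟩ := hf.exists_symm
  refine ⟨g, hg, ?_⟩
  rw [hgf, latticeVolume_convexHull_eq_factorial_mul_coeff hTne hT hdim hf.natDegree_le
    hf.eval_natCast]

section Polytope

variable {S : Set (Fin d → ℝ)}

lemma finite_faces (hS : S.Finite) (p : ℕ) : (faces (convexHull ℝ S) p).Finite :=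
  (finite_exposed hS).subset fun _ hF => hF.2.1

lemma interiorPoints_eq_sum (hS : S.Finite) (p t : ℕ) :
    interiorPoints (convexHull ℝ S) p t =
      ∑ F ∈ (finite_faces hS p).toFinset, interiorLatticeCount F t :=
  finsum_mem_eq_finite_toFinset_sum _ _

lemma polyDim_le_of_mem_faces (hF : F ∈ faces P p) : p ≤ polyDim P :=
  hF.2.2.symm.trans_le (Submodule.finrank_mono (vectorSpan_mono ℝ hF.2.1.subset))

lemma mem_intrinsicInterior_smul_iff {x : Fin d → ℝ} (hF : Convex ℝ F) (ht : 1 ≤ t) :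
    x ∈ intrinsicInterior ℝ ((t : ℝ) • F) ↔ (t : ℝ)⁻¹ • x ∈ intrinsicInterior ℝ F := by
  have ht0 : (0 : ℝ) < t := by exact_mod_cast ht
  rw [← smul_mem_intrinsicInterior_smul_iff hF ht0, smul_inv_smul₀ ht0.ne']

lemma finite_intLattice_inter_smul {F : Set (Fin d → ℝ)} (hF : Bornology.IsBounded F) (r : ℝ) :
    {x | x ∈ intLattice d ∧ x ∈ r • F}.Finite := by
  obtain ⟨R, hR⟩ := (hF.smul₀ r).exists_norm_le
  exact (finite_intLattice_norm_le d R).subset fun x hx => ⟨hx.1, hR x hx.2⟩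

lemma setOf_mem_smul_eq_biUnion_intrinsicInterior (hS : S.Finite)
    (hF : IsExposed ℝ (convexHull ℝ S) F) (ht : 1 ≤ t) :
    {x | x ∈ intLattice d ∧ x ∈ (t : ℝ) • F} =
      ⋃ G ∈ {G | IsExposed ℝ (convexHull ℝ S) G ∧ G ⊆ F},
        {x | x ∈ intLattice d ∧ x ∈ intrinsicInterior ℝ ((t : ℝ) • G)} := by
  have ht0 : (t : ℝ) ≠ 0 := by positivity
  ext x
  simp only [Set.mem_ofPred_eq, Set.mem_iUnion, exists_prop]
  constructor
  · rintro ⟨hxL, hx⟩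
    rw [Set.mem_smul_set_iff_inv_smul_mem₀ ht0] at hx
    obtain ⟨G, hGF, hG, hxG⟩ := exists_face_mem_intrinsicInterior hS hF hx
    exact ⟨G, ⟨hG, hGF⟩, hxL,
      (mem_intrinsicInterior_smul_iff (hG.convex (convex_convexHull ℝ S)) ht).2 hxG⟩
  · rintro ⟨G, ⟨-, hGF⟩, hxL, hxG⟩
    exact ⟨hxL, Set.smul_set_mono hGF (intrinsicInterior_subset hxG)⟩

lemma latticeCount_eq_finsum (hS : S.Finite) (hF : IsExposed ℝ (convexHull ℝ S) F) (ht : 1 ≤ t) :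
    latticeCount F t = ∑ᶠ G ∈ {G | IsExposed ℝ (convexHull ℝ S) G ∧ G ⊆ F},
      interiorLatticeCount G t := by
  have hbdd : Bornology.IsBounded F :=
    (hS.isCompact_convexHull (𝕜 := ℝ)).isBounded.subset hF.subset
  have hconv : Convex ℝ (convexHull ℝ S) := convex_convexHull ℝ S
  rw [latticeCount, setOf_mem_smul_eq_biUnion_intrinsicInterior hS hF ht]
  refine ((finite_exposed hS).subset fun _ hG => hG.1).ncard_biUnion (fun G hG => ?_) ?_
  · exact (finite_intLattice_inter_smul (hbdd.subset hG.2) t).subset fun x hx =>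
      ⟨hx.1, intrinsicInterior_subset hx.2⟩
  · intro G hG G' hG' hne
    refine Set.disjoint_left.2 fun x hx hx' => hne ?_
    exact exposed_eq_of_mem_intrinsicInterior hconv hG.1 hG'.1
      ((mem_intrinsicInterior_smul_iff (hG.1.convex hconv) ht).1 hx.2)
      ((mem_intrinsicInterior_smul_iff (hG'.1.convex hconv) ht).1 hx'.2)

open Classical in
lemma latticeCount_eq_sum_faces (hS : S.Finite) (hF : IsExposed ℝ (convexHull ℝ S) F)
    (ht : 1 ≤ t) :
    latticeCount F t = ∑ q ∈ range (polyDim (convexHull ℝ S) + 1),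
      ∑ G ∈ (finite_faces hS q).toFinset with G ⊆ F, interiorLatticeCount G t := by
  have hempty : interiorLatticeCount (∅ : Set (Fin d → ℝ)) t = 0 := by
    simp [interiorLatticeCount]
  have hfin : {G | IsExposed ℝ (convexHull ℝ S) G ∧ G ⊆ F}.Finite :=
    (finite_exposed hS).subset fun _ hG => hG.1
  have hdim : ∀ G ∈ {G ∈ hfin.toFinset | G.Nonempty},
      polyDim G ∈ range (polyDim (convexHull ℝ S) + 1) := fun G hG => by
    obtain ⟨hG, hne⟩ := mem_filter.1 hG
    exact mem_range_succ_iff.2 (polyDim_le_of_mem_faces ⟨hne, (hfin.mem_toFinset.1 hG).1, rfl⟩)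
  have hnonempty : ∀ G ∈ hfin.toFinset, interiorLatticeCount G t ≠ 0 → G.Nonempty :=
    fun G _ hG => Set.nonempty_iff_ne_empty.2 fun h => hG (h ▸ hempty)
  rw [latticeCount_eq_finsum hS hF ht, finsum_mem_eq_finite_toFinset_sum _ hfin,
    ← sum_filter_of_ne hnonempty, ← sum_fiberwise_of_maps_to hdim]
  refine sum_congr rfl fun q _ => sum_congr ?_ fun _ _ => rfl
  ext G
  simp only [mem_filter, Set.Finite.mem_toFinset, Set.mem_ofPred_eq, faces]
  tauto

theorem IsSimplePolytope.sum_latticeCount_faces (hs : IsSimplePolytope (convexHull ℝ S))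
    (hS : S.Finite) (hp : p ≤ polyDim (convexHull ℝ S)) (ht : 1 ≤ t) :
    ∑ F ∈ (finite_faces hS p).toFinset, latticeCount F t =
      ∑ q ∈ range (polyDim (convexHull ℝ S) + 1),
        (polyDim (convexHull ℝ S) - q).choose (polyDim (convexHull ℝ S) - p) *
          interiorPoints (convexHull ℝ S) q t := by
  classical
  have hcount : ∀ q, ∀ G ∈ (finite_faces hS q).toFinset,
      #{F ∈ (finite_faces hS p).toFinset | G ⊆ F} =
        (polyDim (convexHull ℝ S) - q).choose (polyDim (convexHull ℝ S) - p) := fun q G hG => by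
    rw [← hs.ncard_faces hS hp ((finite_faces hS q).mem_toFinset.1 hG), ← Set.ncard_coe_finset]
    simp
  rw [sum_congr rfl fun F hF =>
    latticeCount_eq_sum_faces hS ((finite_faces hS p).mem_toFinset.1 hF).2.1 ht, sum_comm]
  refine sum_congr rfl fun q _ => ?_
  rw [interiorPoints_eq_sum hS, mul_sum, sum_comm' (t' := (finite_faces hS q).toFinset)
    (s' := fun G => {F ∈ (finite_faces hS p).toFinset | G ⊆ F})
    (by simp only [mem_filter]; tauto)]
  refine sum_congr rfl fun G hG => ?_
  rw [sum_const, hcount q G hG, smul_eq_mul]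

end Polytope

lemma IsLatticePolytope.exists_isEhrhartPair_faces {S : Set (Fin d → ℝ)}
    (hP : IsLatticePolytope (convexHull ℝ S)) (hS : S.Finite) (p : ℕ) :
    ∃ g : ℝ[X], IsEhrhartPair p g (interiorPoints (convexHull ℝ S) p)
        (fun t => ∑ F ∈ (finite_faces hS p).toFinset, latticeCount F t) ∧
      ∑ᶠ F ∈ faces (convexHull ℝ S) p, latticeVolume F = p ! * g.coeff p := by
  have hface : ∀ F ∈ (finite_faces hS p).toFinset, _ := fun F hF =>
    hP.exists_isEhrhartPair_face ((finite_faces hS p).mem_toFinset.1 hF)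
  choose! g hg hvol using hface
  refine ⟨∑ F ∈ (finite_faces hS p).toFinset, g F, ?_, ?_⟩
  · rw [funext (interiorPoints_eq_sum hS p)]
    exact IsEhrhartPair.sum hg
  · rw [finsum_mem_eq_finite_toFinset_sum _ (finite_faces hS p), finsetSum_coeff, mul_sum]
    exact sum_congr rfl hvol

theorem discriminantNumber_eq_sum {n m : ℕ} (hP : IsLatticePolytope P) (hn : polyDim P = n)
    (hs : IsSimplePolytope P) (hm : m ≤ n + 1) :
    discriminantNumber P = ∑ p ∈ range (n + 1), ∑ i ∈ range (n + 1),
      ((-1) ^ (n + 1 + m + (i + 1)) * ((p + 1).choose (m + (i + 1)) : ℝ) +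
        (-1) ^ (m + (i + 1)) * ((p + 1).choose (n + 1 - m + (i + 1)) : ℝ)) *
        (((i + 1 : ℕ) : ℝ) * interiorPoints P p (i + 1)) := by
  obtain ⟨S, hS, -, rfl⟩ := hP.exists_hull
  choose g hg hvol using hP.exists_isEhrhartPair_faces hS
  rw [← sum_coeff_eq_of_dehnSommerville hm (fun p _ => (hg p).natDegree_le)
    (fun p _ => (hg p).eval_natCast) fun p hp k hk => ?_, discriminantNumber, hn]
  · refine sum_congr rfl fun p _ => ?_
    rw [hvol, Nat.factorial_succ]
    push_cast
    ring
  · rw [(hg p).eval_neg k hk, hs.sum_latticeCount_faces hS (hp.trans_eq hn.symm) hk, hn]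
    push_cast
    rfl

lemma neg_one_zpow_sub (m i : ℕ) : (-1 : ℝ) ^ ((m : ℤ) - (i : ℤ)) = (-1) ^ (m + i) := by
  rw [zpow_sub₀ (by norm_num), zpow_natCast, zpow_natCast, pow_add, div_eq_mul_inv, ← inv_pow]
  norm_num

lemma sum_range_eq_sum_Icc {R : Type*} [AddCommMonoid R] {n m : ℕ} {c : ℕ → ℕ → R}
    (hc : ∀ p i, p + 1 < m + i → c p i = 0) :
    ∑ p ∈ range (n + 1), ∑ i ∈ range (n + 1), c p (i + 1) =
      ∑ p ∈ Icc m n, ∑ i ∈ Icc 1 (p + 1 - m), c p i := by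
  have hinner : ∀ p ∈ range (n + 1), ∑ i ∈ range (n + 1), c p (i + 1) =
      ∑ i ∈ Icc 1 (p + 1 - m), c p i := fun p hp => by
    rw [range_eq_Ico, sum_Ico_add' (c p) 0 (n + 1) 1]
    refine (sum_subset (fun i hi => ?_) fun i hi hi' => hc p i ?_).symm <;>
      simp only [mem_range, mem_Icc, mem_Ico] at * <;> omega
  rw [sum_congr rfl hinner]
  refine (sum_subset (fun p hp => ?_) fun p hp hp' => ?_).symm
  · simp only [mem_range, mem_Icc] at *
    omega
  · rw [Icc_eq_empty (by simp only [mem_range, mem_Icc] at *; omega), sum_empty]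

end DiscriminantFormula

theorem theorem2 {d n : ℕ} (P : Set (Fin d → ℝ)) (hP : IsLatticePolytope P)
    (hn : polyDim P = n) (hs : IsSimplePolytope P) :
    (∀ m : ℕ, n + 1 = 2 * m →
      discriminantNumber P =
        ∑ p ∈ Finset.Icc m n, ∑ i ∈ Finset.Icc 1 (p + 1 - m),
          (-1 : ℝ) ^ ((m : ℤ) - (i : ℤ)) * ((p + 1).choose (m + i) : ℝ) * 2 * (i : ℝ) *
            (interiorPoints P p i : ℝ)) ∧
    (∀ m : ℕ, n = 2 * m →
      discriminantNumber P =
        ∑ p ∈ Finset.Icc m n, ∑ i ∈ Finset.Icc 1 (p + 1 - m),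
          (-1 : ℝ) ^ ((m : ℤ) + 1 - (i : ℤ)) *
            (((p + 1).choose (m + i) : ℝ) - ((p + 1).choose (m + i + 1) : ℝ)) * (i : ℝ) *
            (interiorPoints P p i : ℝ)) := by
  refine ⟨fun m hm => ?_, fun m hm => ?_⟩
  · rw [discriminantNumber_eq_sum hP hn hs (m := m) (by omega), ← sum_range_eq_sum_Icc]
    · refine Finset.sum_congr rfl fun p _ => Finset.sum_congr rfl fun i _ => ?_
      rw [neg_one_zpow_sub, show n + 1 - m = m by omega, hm, add_assoc (2 * m), pow_add _ (2 * m),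
        pow_mul, neg_one_sq, one_pow]
      ring
    · intro p i hpi
      rw [Nat.choose_eq_zero_of_lt hpi]
      simp
  · rw [discriminantNumber_eq_sum hP hn hs (m := m) (by omega), ← sum_range_eq_sum_Icc]
    · refine Finset.sum_congr rfl fun p _ => Finset.sum_congr rfl fun i _ => ?_
      have hsign := neg_one_zpow_sub (m + 1) (i + 1)
      push_cast at hsign ⊢
      rw [hsign, show n + 1 - m + (i + 1) = m + (i + 1) + 1 by omega,
        show n + 1 + m + (i + 1) = 2 * m + (m + 1 + (i + 1)) by omega, pow_add _ (2 * m), pow_mul,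
        neg_one_sq, one_pow]
      ring
    · intro p i hpi
      rw [Nat.choose_eq_zero_of_lt hpi, Nat.choose_eq_zero_of_lt (by omega)]
      simp
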